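/- Let $L>0$, let $q\ge 1$ be an integer and let $F:\mathbb R\to\mathbb C$ be an $L$-periodic piecewise $C^q$ function with $J$ jump points $\xi_1,\dots,\xi_J$ modulo $L$; that is, on every bounded open interval containing none of the points $\xi_j+nL$ ($n\in\mathbb Z$), $F$ coincides with a function that is $C^q$ on the closed interval. Let $\sigma:\mathbb R\to\mathbb R$ be a spectral filter of order $q$: $\sigma\in C^{q-1}(\mathbb R)$, $\sigma(0)=1$, $\sigma^{(\ell)}(0)=0$ for $1\le \ell\le q-1$, and $\sigma(\eta)=0$ for $|\eta|\ge 1$. Put $\omega_k=2\pi k/L$ and $\hat F_k=\frac1L\int_0^L F(y)e^{-i\omega_k y}\,dy$, and for a cutoff $\Omega>0$ let $$F^{\Omega,\sigma}(x)=\sum_{|\omega_k|\le\Omega}\hat F_k\,\sigma(\omega_k/\Omega)\,e^{i\omega_k x}$$ be the filtered spectral reconstruction of $F$ (for $\Omega=2\pi\nu/L$ this is the filtered partial sum over the $N=2\nu+1$ modes $|k|\le\nu$). Then for every real $p\ge 1$ with $p(q-1)>1$, $$\|F-F^{\Omega,\sigma}\|_{L^p([0,L])}=O(\Omega^{-1/p})\qquad(\Omega\to\infty),$$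 with an implied constant independent of $\Omega$. In particular, if $q-1>1$, then $\|F-F^{\Omega,\sigma}\|_{L^1([0,L])}=O(\Omega^{-1})$. -/

import Mathlib

open MeasureTheory Filter

/-- `F` is an `L`-periodic, piecewise `C^q` function whose break points, modulo the period `L`, are
among `ξ 0, …, ξ (J-1)`: on every bounded open interval that contains no point `ξ j + n L`, the
function `F` coincides with a `C^q` function defined up to (and beyond) the end points. So `F` and
its derivatives up to order `q` have finite one-sided limits at the break points, where they may
jump, and the values of `F` at the break points are arbitrary. -/
structure IsPeriodicPiecewiseContDiff (L : ℝ) (q : ℕ) {J : ℕ} (ξ : Fin J → ℝ) (F : ℝ → ℂ) :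
    Prop where
  periodic : Function.Periodic F L
  piecewise : ∀ a b : ℝ, a < b → (∀ (j : Fin J) (n : ℤ), ξ j + n * L ∉ Set.Ioo a b) →
    ∃ g : ℝ → ℂ, ContDiff ℝ q g ∧ Set.EqOn F g (Set.Ioo a b)

/-- `σ` is a real spectral filter of order `q`. -/
structure IsSpectralFilter (q : ℕ) (σ : ℝ → ℝ) : Prop where
  map_zero : σ 0 = 1
  iteratedDeriv_zero : ∀ l : ℕ, 1 ≤ l → l ≤ q - 1 → iteratedDeriv l σ 0 = 0
  eq_zero : ∀ η : ℝ, 1 ≤ |η| → σ η = 0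
  contDiff : ContDiff ℝ (q - 1 : ℕ) σ

/-- The filtered Fourier reconstruction of an `L`-periodic function `F` with frequency cutoff `Ω`:
with the frequencies `ω_k = 2πk/L`, the sum over all integers `k` with `|ω_k| ≤ Ω` of
`F̂_k σ(ω_k / Ω) exp(i ω_k x)`, where `F̂_k = (1/L) ∫_0^L F(y) exp(-i ω_k y) dy`. -/
noncomputable def filteredReconstruction {L : ℝ} (hL : 0 < L) (F : ℝ → ℂ) (σ : ℝ → ℝ)
    (Ω : ℝ) (x : ℝ) : ℂ :=
  ∑ k ∈ Finset.Icc (-⌊L * Ω / (2 * Real.pi)⌋) ⌊L * Ω / (2 * Real.pi)⌋,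
    fourierCoeffOn hL F k * (σ (2 * Real.pi * k / L / Ω) : ℂ) *
      Complex.exp (Complex.I * (2 * Real.pi * k / L : ℝ) * x)

/-- At the cutoff `Ω = 2πν/L` the reconstruction is the filtered partial sum with the
`N = 2ν + 1` Fourier modes `-ν, …, ν`. -/
theorem filteredReconstruction_nat {L : ℝ} (hL : 0 < L) (F : ℝ → ℂ) (σ : ℝ → ℝ)
    (ν : ℕ) (x : ℝ) :
    filteredReconstruction hL F σ (2 * Real.pi * ν / L) x =
      ∑ k ∈ Finset.Icc (-(ν : ℤ)) ν, fourierCoeffOn hL F k * (σ ((k : ℝ) / ν) : ℂ) *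
        Complex.exp (Complex.I * k * (2 * Real.pi / L) * x) := by
  have hpi := Real.pi_ne_zero
  have h1 : L * (2 * Real.pi * ν / L) / (2 * Real.pi) = ((ν : ℤ) : ℝ) := by
    push_cast
    field_simp
  unfold filteredReconstruction
  rw [h1, Int.floor_intCast]
  refine Finset.sum_congr rfl fun k _ => ?_
  have h2 : 2 * Real.pi * k / L / (2 * Real.pi * ν / L) = (k : ℝ) / ν := by
    rw [div_div_div_cancel_right₀ hL.ne', mul_div_mul_left _ _ (by positivity)]
  rw [h2]
  congr 2
  push_cast
  ring

/-! ### Power sums -/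

/-! Put `h = 2π/(LΩ)`: the error of the reconstruction has Fourier coefficients `(1 - σ(hk)) F̂_k`.
Two integrations by parts on each smooth piece write `F` as a finite combination of translated
sawtooth waves plus a remainder with coefficients `O(k⁻²)`
(`HasFilteredRate.indicator_of_contDiff`). The condition `p(q-1) > 1` gives `q ≥ 2`, and `q ≥ 3`
when `p = 1`; this is all the regularity needed.

The remainder has sup-norm error at most a constant times `∑ |1 - σ(hk)|/k²`. Flatness of `σ` at the
origin makes this `O(h^(1/p))`.

For a sawtooth with jump at `ξ`, let `E` be the error and `w = |1 - exp(2πi(x-ξ)/L)|`, which is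
comparable to the distance to the jump modulo `L`. Multiplying `E` by the function inside the
modulus takes backward differences of the coefficients `(1 - σ(hk))/(iω_k)`, up to a phase.

If `p > 1`, splitting the series at frequency index about `1/w` gives `w^θ |E| ≤ C h^θ` for every `0
< θ < 1` (`FilterBound.exists_ae_norm_sawtooth_sub_le`). One `θ` below `1/p` and one above bound
`|E|^p` by an integrable profile in `w/h`, so its integral is `O(h)`.

If `p = 1`, an exponent `θ > 1` would be needed. Instead, Parseval gives `∫ |E|² = O(h)` and `∫
w²|E|² = O(h³)` (`FilterBound.exists_integral_sq_sawtooth_sub_le`), and `|E| ≤ |E|² + h⁻² w² |E|² +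
min(1, (w/h)⁻²)` integrates to `O(h)`. -/

theorem natCast_rpow_sub_one_le {θ : ℝ} (h0 : 0 < θ) (h1 : θ ≤ 1) (n : ℕ) :
    θ * ((n : ℝ) + 1) ^ (θ - 1) ≤ ((n : ℝ) + 1) ^ θ - (n : ℝ) ^ θ := by
  have hn : (0 : ℝ) < (n : ℝ) + 1 := by positivity
  have hs : (-1 : ℝ) ≤ -(1 / ((n : ℝ) + 1)) := by
    rw [neg_le_neg_iff, div_le_one hn]; linarith [n.cast_nonneg (α := ℝ)]
  have h := rpow_one_add_le_one_add_mul_self hs h0.le h1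
  have e1 : 1 + -(1 / ((n : ℝ) + 1)) = n / (n + 1) := by field_simp; ring
  rw [e1, Real.div_rpow n.cast_nonneg hn.le, div_le_iff₀ (by positivity)] at h
  rw [Real.rpow_sub_one hn.ne']
  calc _ = θ * (1 / ((n : ℝ) + 1)) * ((n : ℝ) + 1) ^ θ := by ring
    _ ≤ _ := by linarith

theorem sum_range_rpow_sub_one_le {θ : ℝ} (h0 : 0 < θ) (h1 : θ ≤ 1) (K : ℕ) :
    ∑ n ∈ Finset.range K, ((n : ℝ) + 1) ^ (θ - 1) ≤ (K : ℝ) ^ θ / θ := by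
  rw [le_div_iff₀ h0]
  induction K with
  | zero => simp [h0.ne']
  | succ K ih =>
    rw [Finset.sum_range_succ, add_mul]
    have := natCast_rpow_sub_one_le h0 h1 K
    push_cast
    linarith

/-- Bernoulli's inequality with exponent `1 - θ`, in a form that telescopes; the factor 2 pays for
replacing `n + 1` by `2n`. -/
theorem natCast_rpow_sub_two_le {θ : ℝ} (h0 : 0 < θ) (h1 : θ < 1) {n : ℕ} (hn : 1 ≤ n) :
    (n : ℝ) ^ (θ - 2) ≤ 2 / (1 - θ) * ((n : ℝ) ^ (θ - 1) - ((n : ℝ) + 1) ^ (θ - 1)) := by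
  have hn' : (1 : ℝ) ≤ n := by exact_mod_cast hn
  have hn0 : (0 : ℝ) < n := by linarith
  have hs : (-1 : ℝ) ≤ -(1 / ((n : ℝ) + 1)) := by
    rw [neg_le_neg_iff, div_le_one (by positivity)]; linarith
  have h := rpow_one_add_le_one_add_mul_self hs (p := 1 - θ) (by linarith) (by linarith)
  have e1 : 1 + -(1 / ((n : ℝ) + 1)) = n / (n + 1) := by field_simp; ring
  rw [e1] at h
  have e2 : ((n : ℝ) + 1) ^ (θ - 1) = (n : ℝ) ^ (θ - 1) * ((n : ℝ) / (n + 1)) ^ (1 - θ) := by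
    rw [Real.div_rpow hn0.le (by positivity), ← mul_div_assoc, ← Real.rpow_add hn0,
      show θ - 1 + (1 - θ) = 0 by ring, Real.rpow_zero, one_div, ← Real.rpow_neg (by positivity)]
    congr 1; ring
  have e3 : (n : ℝ) ^ (θ - 2) = (n : ℝ) ^ (θ - 1) / n := by
    rw [← Real.rpow_sub_one hn0.ne']; congr 1; ring
  have hp : 0 < (n : ℝ) ^ (θ - 1) := by positivity
  have h1' : 0 < 1 - θ := by linarith
  rw [e2, e3, div_mul_eq_mul_div, div_le_div_iff₀ hn0 h1']
  have h3 : (1 - θ) / (2 * n) ≤ 1 - ((n : ℝ) / (n + 1)) ^ (1 - θ) := by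
    have : (1 - θ) / (2 * n) ≤ (1 - θ) / (n + 1) := by gcongr; linarith
    have e : (1 - θ) / ((n : ℝ) + 1) = (1 - θ) * (1 / (n + 1)) := by ring
    linarith
  rw [div_le_iff₀ (by positivity)] at h3
  nlinarith [mul_le_mul_of_nonneg_left h3 hp.le]

/-- Total variation of a sequence after its first terms have been removed. -/
theorem sum_range_norm_sub_truncate_le {θ A : ℝ} (h0 : 0 < θ) (h1 : θ < 1) (hA : 0 ≤ A)
    {b : ℕ → ℂ} (hb : ∀ n : ℕ, 1 ≤ n → ‖b n‖ ≤ A * (n : ℝ) ^ (θ - 1))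
    (hd : ∀ n : ℕ, 1 ≤ n → ‖b (n + 1) - b n‖ ≤ A * (n : ℝ) ^ (θ - 2)) {K : ℕ} (hK : 1 ≤ K)
    (N : ℕ) :
    ∑ n ∈ Finset.range N, ‖(if n + 1 ≤ K then 0 else b (n + 1)) - (if n ≤ K then 0 else b n)‖ ≤
      (2 / (1 - θ) + 1) * A * (K : ℝ) ^ (θ - 1) := by
  set B : ℝ := 2 / (1 - θ) with hB
  have hB0 : 0 ≤ B := by have : 0 < 1 - θ := by linarith
                         positivity
  -- A potential whose decrease dominates each term of the sum. It is constant up to `K`; the extra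
  -- `1` in `B + 1` pays for the single jump from `0` to `b (K + 1)`.
  let U : ℕ → ℝ := fun n => if n ≤ K then (B + 1) * A * (K : ℝ) ^ (θ - 1)
    else B * A * (n : ℝ) ^ (θ - 1)
  have hU : ∀ n, 0 ≤ U n := by
    intro n; simp only [U]; split_ifs <;> positivity
  suffices h : ∑ n ∈ Finset.range N,
      ‖(if n + 1 ≤ K then 0 else b (n + 1)) - (if n ≤ K then 0 else b n)‖ + U N ≤ U 0 by
    have : U 0 = (B + 1) * A * (K : ℝ) ^ (θ - 1) := by simp [U]
    linarith [hU N]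
  induction N with
  | zero => simp
  | succ N ih =>
    rw [Finset.sum_range_succ]
    suffices h : ‖(if N + 1 ≤ K then 0 else b (N + 1)) - (if N ≤ K then 0 else b N)‖ ≤
        U N - U (N + 1) by linarith
    rcases lt_trichotomy N K with h | h | h
    · simp [U, h.le, Nat.succ_le_of_lt h]
    · subst h
      have hm : ((N : ℝ) + 1) ^ (θ - 1) ≤ (N : ℝ) ^ (θ - 1) :=
        Real.rpow_le_rpow_of_nonpos (by exact_mod_cast hK) (by linarith) (by linarith)
      have hb' := hb (N + 1) (by omega)
      push_cast at hb'
      simp only [U, le_refl, if_true, Nat.not_succ_le_self, if_false, sub_zero]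
      push_cast
      nlinarith [mul_le_mul_of_nonneg_left hm (mul_nonneg hB0 hA),
        mul_le_mul_of_nonneg_left hm hA]
    · have hN : 1 ≤ N := by omega
      simp only [U, not_le.2 h, not_le.2 (h.trans (Nat.lt_succ_self N)), if_false]
      push_cast
      calc _ ≤ A * (N : ℝ) ^ (θ - 2) := hd N hN
        _ ≤ A * (B * ((N : ℝ) ^ (θ - 1) - ((N : ℝ) + 1) ^ (θ - 1))) := by
          gcongr; exact natCast_rpow_sub_two_le h0 h1 hN
        _ = _ := by ring

/-- Each term is at most `4h²/(1 + h(n+1))²`, and such terms are dominated by the increments of `4h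
· t/(1 + t)` at `t = hn`. -/
theorem sum_range_min_sq_le {h : ℝ} (hh : 0 < h) (N : ℕ) :
    ∑ n ∈ Finset.range N, min (h ^ 2) (1 / ((n : ℝ) + 1) ^ 2) ≤ 4 * h := by
  suffices H : ∑ n ∈ Finset.range N, min (h ^ 2) (1 / ((n : ℝ) + 1) ^ 2) ≤
      4 * h * (h * N / (1 + h * N)) by
    refine H.trans (mul_le_of_le_one_right (by positivity) ?_)
    rw [div_le_one (by positivity)]; linarith
  induction N with
  | zero => simp
  | succ N ih =>
    rw [Finset.sum_range_succ]
    suffices H : min (h ^ 2) (1 / ((N : ℝ) + 1) ^ 2) ≤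
        4 * h * (h * (N + 1) / (1 + h * (N + 1)) - h * N / (1 + h * N)) by
      push_cast; linarith
    have e : h * ((N : ℝ) + 1) / (1 + h * (N + 1)) - h * N / (1 + h * N) =
        h / ((1 + h * (N + 1)) * (1 + h * N)) := by
      field_simp; ring
    have hN : (0 : ℝ) ≤ N := N.cast_nonneg
    have le1 : h / (1 + h * (N + 1)) ^ 2 ≤ h / ((1 + h * (N + 1)) * (1 + h * N)) := by
      rw [sq]; gcongr; linarith
    rw [e]
    refine le_trans ?_ (mul_le_mul_of_nonneg_left le1 (by positivity))
    rw [← mul_div_assoc]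
    rcases le_total (h * ((N : ℝ) + 1)) 1 with hc | hc
    · refine (min_le_left _ _).trans ?_
      rw [le_div_iff₀ (by positivity)]
      have : (1 + h * ((N : ℝ) + 1)) ^ 2 ≤ 4 := by
        have : 0 ≤ h * ((N : ℝ) + 1) := by positivity
        nlinarith
      nlinarith [sq_nonneg h]
    · refine (min_le_right _ _).trans ?_
      rw [div_le_div_iff₀ (by positivity) (by positivity)]
      nlinarith

/-- The split into `n + 1` and `-n` suits backward differences: `k = n + 1` and `k = -n` both
compare indices of absolute values `n` and `n + 1`. -/
theorem Int.summable_and_tsum_le_of_sum_range_le {g : ℤ → ℝ} (hg : ∀ k, 0 ≤ g k) {B : ℝ}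
    (h1 : ∀ N : ℕ, ∑ n ∈ Finset.range N, g (n + 1) ≤ B)
    (h2 : ∀ N : ℕ, ∑ n ∈ Finset.range N, g (-n) ≤ B) :
    Summable g ∧ ∑' k, g k ≤ 2 * B := by
  have s1 := summable_of_sum_range_le (fun n => hg _) h1
  have s2 := summable_of_sum_range_le (fun n => hg _) h2
  have H : HasSum (fun k : ℤ => g (-k)) (∑' n : ℕ, g (-n) + ∑' n : ℕ, g (n + 1)) := by
    refine HasSum.of_nat_of_neg_add_one s2.hasSum ?_
    simpa using s1.hasSum
  have H' : HasSum g (∑' n : ℕ, g (-n) + ∑' n : ℕ, g (n + 1)) := by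
    rw [← (Equiv.neg ℤ).hasSum_iff]; exact H
  refine ⟨H'.summable, ?_⟩
  rw [H'.tsum_eq]
  linarith [s1.tsum_le_of_sum_range_le h1, s2.tsum_le_of_sum_range_le h2]

theorem summable_and_tsum_min_sq_le {h : ℝ} (hh : 0 < h) :
    Summable (fun k : ℤ => min (h ^ 2) (1 / (k : ℝ) ^ 2)) ∧
      ∑' k : ℤ, min (h ^ 2) (1 / (k : ℝ) ^ 2) ≤ 8 * h := by
  have := Int.summable_and_tsum_le_of_sum_range_le
    (g := fun k : ℤ => min (h ^ 2) (1 / (k : ℝ) ^ 2)) (fun k => by positivity) (B := 4 * h)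
    (fun N => by simpa using sum_range_min_sq_le hh N) (fun N => ?_)
  · exact ⟨this.1, by linarith [this.2]⟩
  · cases N with
    | zero => simp; positivity
    | succ N =>
      rw [Finset.sum_range_succ']
      -- The term at index 0 vanishes because `1 / 0 = 0`.
      have := sum_range_min_sq_le hh N
      have e : ∀ x : ℝ, (-1 + -x) ^ 2 = (x + 1) ^ 2 := fun x => by ring
      simpa [sq_nonneg h, e] using this

/-! ### Spectral filters -/

/-- Quantitative flatness at the origin of a filter `σ` and of its derivative. -/
structure FilterBound (σ : ℝ → ℝ) (r M : ℝ) : Prop where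
  differentiable : Differentiable ℝ σ
  nonneg : 0 ≤ M
  sub_le : ∀ θ η : ℝ, 0 ≤ θ → θ ≤ r → η ≠ 0 → |1 - σ η| ≤ M * |η| ^ θ
  deriv_le : ∀ θ η : ℝ, 0 ≤ θ → θ ≤ r → η ≠ 0 → |deriv σ η| ≤ M * |η| ^ (θ - 1)

/-- Lowering the exponent only weakens the bounds for `|η| ≤ 1`; beyond that `σ` vanishes and `M ≥
1` is enough. -/
theorem FilterBound.of_le {σ : ℝ → ℝ} {r M : ℝ} (hσ : Differentiable ℝ σ) (hM : 1 ≤ M)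
    (hzero : ∀ η : ℝ, 1 ≤ |η| → σ η = 0)
    (h1 : ∀ η, |1 - σ η| ≤ M * |η| ^ r) (h2 : ∀ η, |deriv σ η| ≤ M * |η| ^ (r - 1)) :
    FilterBound σ r M where
  differentiable := hσ
  nonneg := by linarith
  sub_le θ η h0 hr hη := by
    have hη' : 0 < |η| := abs_pos.2 hη
    rcases le_total |η| 1 with h | h
    · refine (h1 η).trans ?_
      gcongr ?_ * ?_
      exact Real.rpow_le_rpow_of_exponent_ge hη' h hr
    · rw [hzero η h, sub_zero, abs_one]
      have := Real.one_le_rpow h h0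
      nlinarith
  deriv_le θ η h0 hr hη := by
    have hη' : 0 < |η| := abs_pos.2 hη
    -- The inequality in the second case must be strict, so that `σ` vanishes on a neighbourhood of
    -- `η`.
    rcases le_or_gt |η| 1 with h | h
    · refine (h2 η).trans ?_
      gcongr ?_ * ?_
      exact Real.rpow_le_rpow_of_exponent_ge hη' h (by linarith)
    · have he : σ =ᶠ[nhds η] fun _ => 0 := by
        filter_upwards [continuous_abs.continuousAt.eventually (lt_mem_nhds h)] with x hx
        exact hzero x hx.le
      rw [he.deriv_eq]
      simp only [deriv_const, abs_zero]
      positivity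

theorem IsSpectralFilter.hasCompactSupport {q : ℕ} {σ : ℝ → ℝ} (hσ : IsSpectralFilter q σ) :
    HasCompactSupport σ :=
  HasCompactSupport.intro (isCompact_Icc (a := (-1 : ℝ)) (b := 1)) fun x hx =>
    hσ.eq_zero x (by
      by_contra h
      exact hx (abs_le.1 (not_le.1 h).le))

theorem IsSpectralFilter.exists_filterBound_one {q : ℕ} {σ : ℝ → ℝ} (hσ : IsSpectralFilter q σ)
    (hq : 2 ≤ q) : ∃ M, FilterBound σ 1 M := by
  have hc : ContDiff ℝ 1 σ := hσ.contDiff.of_le (by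
    have : 1 ≤ q - 1 := by omega
    exact_mod_cast this)
  have hd : Differentiable ℝ σ := hc.differentiable (by simp)
  obtain ⟨C, hC⟩ := hσ.hasCompactSupport.deriv.exists_bound_of_continuous
    (hc.continuous_deriv (by simp))
  refine ⟨max C 1, FilterBound.of_le hd (le_max_right _ _) hσ.eq_zero (fun η => ?_) fun η => ?_⟩
  · have := convex_univ.norm_image_sub_le_of_norm_deriv_le (f := σ) (C := max C 1)
      (fun x _ => hd x) (fun x _ => (hC x).trans (le_max_left _ _)) (Set.mem_univ 0)
      (Set.mem_univ η)
    rw [hσ.map_zero, Real.norm_eq_abs, Real.norm_eq_abs, sub_zero] at this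
    rwa [abs_sub_comm, Real.rpow_one]
  · simpa using Or.inl (hC η)

/-- Since `q ≥ 3`, `σ'(0) = 0` and `σ''` is bounded; the mean value inequality applied to `σ'` and
then to `σ` gives one power of `|η|` each time. -/
theorem IsSpectralFilter.exists_filterBound_two {q : ℕ} {σ : ℝ → ℝ} (hσ : IsSpectralFilter q σ)
    (hq : 3 ≤ q) : ∃ M, FilterBound σ 2 M := by
  have hc : ContDiff ℝ 2 σ := hσ.contDiff.of_le (by
    have : 2 ≤ q - 1 := by omega
    exact_mod_cast this)
  have hd : Differentiable ℝ σ := hc.differentiable (by simp)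
  have hc' : ContDiff ℝ 1 (deriv σ) := by
    have : ContDiff ℝ (1 + 1) σ := by simpa [one_add_one_eq_two] using hc
    exact (contDiff_succ_iff_deriv.1 this).2.2
  have hd' : Differentiable ℝ (deriv σ) := hc'.differentiable (by simp)
  have h0 : deriv σ 0 = 0 := by
    have := hσ.iteratedDeriv_zero 1 le_rfl (by omega)
    rwa [iteratedDeriv_one] at this
  obtain ⟨C, hC⟩ := hσ.hasCompactSupport.deriv.deriv.exists_bound_of_continuous
    (hc'.continuous_deriv (by simp))
  have hC' : ∀ η, |deriv σ η| ≤ max C 1 * |η| := fun η => by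
    have := convex_univ.norm_image_sub_le_of_norm_deriv_le (f := deriv σ) (C := max C 1)
      (fun x _ => hd' x) (fun x _ => (hC x).trans (le_max_left _ _)) (Set.mem_univ 0)
      (Set.mem_univ η)
    simpa [h0] using this
  refine ⟨max C 1, FilterBound.of_le hd (le_max_right _ _) hσ.eq_zero (fun η => ?_) fun η => ?_⟩
  · have := (convex_closedBall (0 : ℝ) |η|).norm_image_sub_le_of_norm_deriv_le (f := σ)
      (C := max C 1 * |η|) (fun x _ => hd x) (fun x hx => (hC' x).trans (by
        have : |x| ≤ |η| := by simpa using hx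
        gcongr)) (x := 0) (y := η) (by simp) (by simp)
    rw [hσ.map_zero, Real.norm_eq_abs, Real.norm_eq_abs, sub_zero] at this
    rw [abs_sub_comm]
    refine this.trans_eq ?_
    norm_num [sq, mul_assoc]
  · refine (hC' η).trans_eq ?_
    norm_num

/-- Mean value inequality for `t ↦ (1 - σ(ht))/t`: the two terms of the derivative contribute `M`
each, and `θ ≤ 2` puts the maximum of `t^(θ-2)` at `t = n`. Allowing `h < 0` covers negative
frequencies. -/
theorem FilterBound.abs_div_sub_div_le {σ : ℝ → ℝ} {r M : ℝ} (hσ : FilterBound σ r M) {h θ : ℝ}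
    (hh : h ≠ 0) (h0 : 0 ≤ θ) (hr : θ ≤ r) (h2 : θ ≤ 2) {n : ℕ} (hn : 1 ≤ n) :
    |(1 - σ (h * (n + 1))) / ((n : ℝ) + 1) - (1 - σ (h * n)) / n| ≤
      2 * M * |h| ^ θ * (n : ℝ) ^ (θ - 2) := by
  have hn0 : (0 : ℝ) < n := by exact_mod_cast hn
  have hder : ∀ t ∈ Set.Icc (n : ℝ) (n + 1), HasDerivWithinAt (fun t : ℝ => (1 - σ (h * t)) / t)
      ((-(deriv σ (h * t) * h) * t - (1 - σ (h * t)) * 1) / t ^ 2)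
      (Set.Icc (n : ℝ) (n + 1)) t := by
    intro t ht
    have ht0 : 0 < t := hn0.trans_le ht.1
    have e1 : HasDerivAt (fun t : ℝ => σ (h * t)) (deriv σ (h * t) * h) t :=
      (hσ.differentiable (h * t)).hasDerivAt.comp t (by simpa using (hasDerivAt_id t).const_mul h)
    exact ((e1.const_sub 1).div (hasDerivAt_id t) ht0.ne').hasDerivWithinAt
  have := (convex_Icc (n : ℝ) (n + 1)).norm_image_sub_le_of_norm_hasDerivWithin_le hder
    (C := 2 * M * |h| ^ θ * (n : ℝ) ^ (θ - 2)) (fun t ht => ?_) (x := (n : ℝ)) (y := (n : ℝ) + 1)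
    (by simp) (by simp)
  · simpa using this
  · have ht0 : 0 < t := hn0.trans_le ht.1
    have hht : h * t ≠ 0 := mul_ne_zero hh ht0.ne'
    have b1 := hσ.sub_le θ (h * t) h0 hr hht
    have b2 := hσ.deriv_le θ (h * t) h0 hr hht
    have hM := hσ.nonneg
    have ha : 0 < |h| := abs_pos.2 hh
    rw [abs_mul, abs_of_pos ht0, Real.mul_rpow ha.le ht0.le] at b1 b2
    have e1 : |h| * |h| ^ (θ - 1) = |h| ^ θ := by
      rw [Real.rpow_sub_one ha.ne']; field_simp
    have e2 : t * t ^ (θ - 1) = t ^ θ := by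
      rw [Real.rpow_sub_one ht0.ne']; field_simp
    have e3 : t ^ (θ - 2) * t ^ 2 = t ^ θ := by
      rw [← Real.rpow_natCast t 2, ← Real.rpow_add ht0]; congr 1; push_cast; ring
    have hmono : t ^ (θ - 2) ≤ (n : ℝ) ^ (θ - 2) :=
      Real.rpow_le_rpow_of_nonpos hn0 ht.1 (by linarith)
    rw [Real.norm_eq_abs, abs_div, abs_of_pos (by positivity : 0 < t ^ 2)]
    refine le_trans ?_ (mul_le_mul_of_nonneg_left hmono (by positivity))
    rw [div_le_iff₀ (by positivity), mul_assoc, e3]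
    calc _ ≤ |deriv σ (h * t)| * |h| * t + |1 - σ (h * t)| := by
          refine (abs_sub _ _).trans ?_
          rw [abs_mul, abs_neg, abs_mul, mul_one, abs_of_pos ht0]
      _ ≤ (M * (|h| ^ (θ - 1) * t ^ (θ - 1))) * |h| * t + M * (|h| ^ θ * t ^ θ) := by gcongr
      _ = M * (|h| * |h| ^ (θ - 1)) * (t * t ^ (θ - 1)) + M * (|h| ^ θ * t ^ θ) := by ring
      _ = _ := by rw [e1, e2]; ring

/-! ### Coefficients of the sawtooth error: size and consecutive differences -/

/-- The `k`-th Fourier coefficient of the sawtooth wave of period `L`. -/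
noncomputable def sawtoothCoeff (L : ℝ) (k : ℤ) : ℂ :=
  (Complex.I * (2 * Real.pi * k / L : ℝ))⁻¹

/-- The Fourier coefficients of the error of the filtered reconstruction of a sawtooth wave. -/
noncomputable def sawtoothErrorCoeff (L : ℝ) (σ : ℝ → ℝ) (h : ℝ) (k : ℤ) : ℂ :=
  ((1 - σ (h * k) : ℝ) : ℂ) * sawtoothCoeff L k

theorem sawtoothCoeff_zero (L : ℝ) : sawtoothCoeff L 0 = 0 := by simp [sawtoothCoeff]

theorem sawtoothErrorCoeff_zero (L : ℝ) (σ : ℝ → ℝ) (h : ℝ) : sawtoothErrorCoeff L σ h 0 = 0 := by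
  simp [sawtoothErrorCoeff, sawtoothCoeff_zero]

theorem norm_sawtoothCoeff {L : ℝ} (hL : 0 < L) (k : ℤ) :
    ‖sawtoothCoeff L k‖ = L / (2 * Real.pi) * |(k : ℝ)|⁻¹ := by
  have := Real.pi_pos
  rw [sawtoothCoeff, norm_inv, norm_mul, Complex.norm_I, one_mul, Complex.norm_real,
    Real.norm_eq_abs, abs_div, abs_mul, abs_of_pos hL, abs_of_pos (by positivity)]
  rw [inv_div, div_mul_eq_div_div, div_eq_mul_inv (L / _)]

theorem FilterBound.norm_sawtoothErrorCoeff_le {L : ℝ} (hL : 0 < L) {σ : ℝ → ℝ} {r M : ℝ}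
    (hσ : FilterBound σ r M) {h θ : ℝ} (hh : 0 < h) (h0 : 0 ≤ θ) (hr : θ ≤ r) {k : ℤ}
    (hk : k ≠ 0) :
    ‖sawtoothErrorCoeff L σ h k‖ ≤ L / Real.pi * M * h ^ θ * |(k : ℝ)| ^ (θ - 1) := by
  have hk' : (k : ℝ) ≠ 0 := by exact_mod_cast hk
  have ha : 0 < |(k : ℝ)| := abs_pos.2 hk'
  have hpi := Real.pi_pos
  have hM := hσ.nonneg
  rw [sawtoothErrorCoeff, norm_mul, norm_sawtoothCoeff hL, Complex.norm_real, Real.norm_eq_abs]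
  have := hσ.sub_le θ (h * k) h0 hr (mul_ne_zero hh.ne' hk')
  rw [abs_mul, abs_of_pos hh, Real.mul_rpow hh.le ha.le] at this
  -- A factor 2 is given away so that this bound and the one for differences share a constant.
  have hle : L / (2 * Real.pi) ≤ L / Real.pi := by gcongr; linarith
  calc _ ≤ M * (h ^ θ * |(k : ℝ)| ^ θ) * (L / Real.pi * |(k : ℝ)|⁻¹) := by gcongr
    _ = _ := by rw [Real.rpow_sub_one ha.ne']; ring

theorem FilterBound.norm_sawtoothErrorCoeff_sub_le {L : ℝ} (hL : 0 < L) {σ : ℝ → ℝ} {r M : ℝ}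
    (hσ : FilterBound σ r M) {h θ : ℝ} (hh : 0 < h) (h0 : 0 ≤ θ) (hr : θ ≤ r) (h2 : θ ≤ 2)
    {n : ℕ} (hn : 1 ≤ n) {ε : ℤ} (hε : ε = 1 ∨ ε = -1) :
    ‖sawtoothErrorCoeff L σ h (ε * (n + 1)) - sawtoothErrorCoeff L σ h (ε * n)‖ ≤
      L / Real.pi * M * h ^ θ * (n : ℝ) ^ (θ - 2) := by
  have hpi := Real.pi_pos
  have hn0 : (0 : ℝ) < n := by exact_mod_cast hn
  have hε2 : (ε : ℝ) * ε = 1 := by rcases hε with rfl | rfl <;> norm_num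
  have hεa : |(ε : ℝ)| = 1 := by rcases hε with rfl | rfl <;> norm_num
  have hε0 : (ε : ℝ) ≠ 0 := by rcases hε with rfl | rfl <;> norm_num
  have key := hσ.abs_div_sub_div_le (h := h * ε) (mul_ne_zero hh.ne' hε0) h0 hr h2 hn
  rw [abs_mul, hεa, mul_one, abs_of_pos hh] at key
  have hs : ∀ m : ℤ, m ≠ 0 → sawtoothErrorCoeff L σ h (ε * m) =
      (((1 - σ (h * ε * m)) / m * (ε * (L / (2 * Real.pi))) : ℝ) : ℂ) * Complex.I⁻¹ := by
    intro m hm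
    have hm' : (m : ℝ) ≠ 0 := by exact_mod_cast hm
    have : (2 * Real.pi * ((ε * m : ℤ) : ℝ) / L)⁻¹ = (ε * (L / (2 * Real.pi))) / m := by
      push_cast
      field_simp
      linarith [hε2, sq (ε : ℝ)]
    rw [sawtoothErrorCoeff, sawtoothCoeff, mul_inv, ← Complex.ofReal_inv, this]
    push_cast
    rw [mul_assoc (h : ℝ)]
    ring
  have hs1 := hs (n + 1) (by omega)
  have hs2 := hs n (by omega)
  rw [hs1, hs2, ← sub_mul, ← Complex.ofReal_sub, ← sub_mul, norm_mul, norm_inv, Complex.norm_I,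
    inv_one, mul_one, Complex.norm_real, Real.norm_eq_abs, abs_mul, abs_mul, hεa, one_mul,
    abs_of_pos (by positivity : 0 < L / (2 * Real.pi))]
  push_cast
  calc _ ≤ 2 * M * h ^ θ * (n : ℝ) ^ (θ - 2) * (L / (2 * Real.pi)) := by gcongr
    _ = _ := by field_simp

/-! ### Fourier coefficients on `[0, L]` -/

/-- The exponential `x ↦ exp (i ω_k x)` with `ω_k = 2πk/L`. -/
noncomputable def fourierMode (L : ℝ) (k : ℤ) (x : ℝ) : ℂ :=
  Complex.exp (Complex.I * (2 * Real.pi * k / L : ℝ) * x)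

theorem norm_fourierMode (L : ℝ) (k : ℤ) (x : ℝ) : ‖fourierMode L k x‖ = 1 := by
  rw [fourierMode, mul_assoc, mul_comm, ← Complex.ofReal_mul, Complex.norm_exp_ofReal_mul_I]

theorem continuous_fourierMode (L : ℝ) (k : ℤ) : Continuous (fourierMode L k) := by
  unfold fourierMode; fun_prop

theorem fourierMode_zero (L : ℝ) (x : ℝ) : fourierMode L 0 x = 1 := by simp [fourierMode]

theorem fourierMode_add (L : ℝ) (j k : ℤ) (x : ℝ) :
    fourierMode L (j + k) x = fourierMode L j x * fourierMode L k x := by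
  simp only [fourierMode, ← Complex.exp_add]
  congr 1; push_cast; ring

theorem fourierMode_add_apply (L : ℝ) (k : ℤ) (x y : ℝ) :
    fourierMode L k (x + y) = fourierMode L k x * fourierMode L k y := by
  simp only [fourierMode, ← Complex.exp_add]
  congr 1; push_cast; ring

theorem fourierMode_neg_apply (L : ℝ) (k : ℤ) (x : ℝ) :
    fourierMode L k (-x) = fourierMode L (-k) x := by
  simp only [fourierMode]
  congr 1; push_cast; ring

theorem fourierMode_sub_apply (L : ℝ) (k : ℤ) (x y : ℝ) :
    fourierMode L k (x - y) = fourierMode L k x * fourierMode L (-k) y := by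
  rw [sub_eq_add_neg, fourierMode_add_apply, fourierMode_neg_apply]

theorem periodic_fourierMode {L : ℝ} (hL : 0 < L) (k : ℤ) :
    Function.Periodic (fourierMode L k) L := by
  intro x
  rw [fourierMode_add_apply]
  have : fourierMode L k L = 1 := by
    rw [fourierMode, ← Complex.exp_int_mul_two_pi_mul_I k]
    congr 1
    have : (L : ℂ) ≠ 0 := by exact_mod_cast hL.ne'
    push_cast; field_simp
  rw [this, mul_one]

theorem hasDerivAt_fourierMode (L : ℝ) (k : ℤ) (x : ℝ) :
    HasDerivAt (fourierMode L k)
      (Complex.I * (2 * Real.pi * k / L : ℝ) * fourierMode L k x) x := by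
  have h := ((Complex.ofRealCLM.hasDerivAt (x := x)).const_mul
    (Complex.I * (2 * Real.pi * k / L : ℝ))).cexp
  simp only [Complex.ofRealCLM_apply, Complex.ofReal_one, mul_one] at h
  rw [mul_comm]
  exact h

/-- The period appears as `L - 0` because `fourierCoeffOn` on `[a, b]` is defined through `AddCircle
(b - a)`. -/
theorem fourier_coe_eq_fourierMode (L : ℝ) (k : ℤ) (x : ℝ) :
    fourier k (x : AddCircle (L - 0)) = fourierMode L k x := by
  rw [fourier_coe_apply, fourierMode]
  congr 1; push_cast; ring

theorem fourierCoeffOn_eq_integral_fourierMode {L : ℝ} (hL : 0 < L) (f : ℝ → ℂ) (k : ℤ) :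
    fourierCoeffOn hL f k = (L : ℂ)⁻¹ * ∫ x in 0..L, fourierMode L (-k) x * f x := by
  rw [fourierCoeffOn_eq_integral]
  simp only [fourier_coe_eq_fourierMode, smul_eq_mul, sub_zero, one_div]
  rw [Complex.real_smul, Complex.ofReal_inv]

theorem MeasureTheory.MemLp.intervalIntegrable_fourierMode_mul {L : ℝ} (hL : 0 < L) {f : ℝ → ℂ}
    (hf : MemLp f 2 (volume.restrict (Set.Ioc 0 L))) (k : ℤ) :
    IntervalIntegrable (fun x => fourierMode L k x * f x) volume 0 L := by
  rw [intervalIntegrable_iff_integrableOn_Ioc_of_le hL.le]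
  exact (hf.integrable (by norm_num)).bdd_mul (c := 1)
    (continuous_fourierMode L k).aestronglyMeasurable
    (ae_of_all _ fun x => (norm_fourierMode L k x).le)

theorem MeasureTheory.MemLp.fourierMode_mul {L : ℝ} {f : ℝ → ℂ} {p : ENNReal}
    (hf : MemLp f p (volume.restrict (Set.Ioc 0 L))) (k : ℤ) :
    MemLp (fun x => fourierMode L k x * f x) p (volume.restrict (Set.Ioc 0 L)) :=
  hf.of_le ((continuous_fourierMode L k).aestronglyMeasurable.mul hf.1)
    (ae_of_all _ fun x => by simp [norm_fourierMode])

theorem memLp_fourierMode (L : ℝ) (k : ℤ) (p : ENNReal) :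
    MemLp (fourierMode L k) p (volume.restrict (Set.Ioc 0 L)) :=
  (memLp_const (1 : ℂ)).of_le (continuous_fourierMode L k).aestronglyMeasurable
    (ae_of_all _ fun x => by simp [norm_fourierMode])

theorem fourierCoeffOn_sub {L : ℝ} (hL : 0 < L) {f g : ℝ → ℂ}
    (hf : MemLp f 2 (volume.restrict (Set.Ioc 0 L)))
    (hg : MemLp g 2 (volume.restrict (Set.Ioc 0 L))) (k : ℤ) :
    fourierCoeffOn hL (fun x => f x - g x) k = fourierCoeffOn hL f k - fourierCoeffOn hL g k := by
  simp only [fourierCoeffOn_eq_integral_fourierMode, mul_sub]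
  rw [intervalIntegral.integral_sub (hf.intervalIntegrable_fourierMode_mul hL _)
    (hg.intervalIntegrable_fourierMode_mul hL _), mul_sub]

theorem fourierCoeffOn_add {L : ℝ} (hL : 0 < L) {f g : ℝ → ℂ}
    (hf : MemLp f 2 (volume.restrict (Set.Ioc 0 L)))
    (hg : MemLp g 2 (volume.restrict (Set.Ioc 0 L))) (k : ℤ) :
    fourierCoeffOn hL (fun x => f x + g x) k = fourierCoeffOn hL f k + fourierCoeffOn hL g k := by
  simp only [fourierCoeffOn_eq_integral_fourierMode, mul_add]
  rw [intervalIntegral.integral_add (hf.intervalIntegrable_fourierMode_mul hL _)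
    (hg.intervalIntegrable_fourierMode_mul hL _), mul_add]

theorem fourierCoeffOn_fourierMode_mul {L : ℝ} (hL : 0 < L) (f : ℝ → ℂ) (j k : ℤ) :
    fourierCoeffOn hL (fun x => fourierMode L j x * f x) k = fourierCoeffOn hL f (k - j) := by
  simp only [fourierCoeffOn_eq_integral_fourierMode, ← mul_assoc, ← fourierMode_add]
  rw [show -k + j = -(k - j) by ring]

theorem fourierCoeffOn_fourierMode {L : ℝ} (hL : 0 < L) (j k : ℤ) :
    fourierCoeffOn hL (fourierMode L j) k = if k = j then 1 else 0 := by
  have : Fact (0 < L - 0) := ⟨by simpa using hL⟩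
  have h := congrFun (fourierCoeff_fourier (T := L - 0) j) k
  rw [fourierCoeff_eq_intervalIntegral _ _ 0] at h
  simp only [fourier_coe_eq_fourierMode, zero_add] at h
  rw [fourierCoeffOn_eq_integral]
  simp only [fourier_coe_eq_fourierMode]
  rw [sub_zero] at h ⊢
  rw [h, Pi.single_apply]

theorem memLp_sum_fourierMode (L : ℝ) (s : Finset ℤ) (u : ℤ → ℂ) (p : ENNReal) :
    MemLp (fun x => ∑ j ∈ s, u j * fourierMode L j x) p (volume.restrict (Set.Ioc 0 L)) :=
  memLp_finsetSum s fun j _ => (memLp_fourierMode L j p).const_mul (u j)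

theorem fourierCoeffOn_sum_fourierMode {L : ℝ} (hL : 0 < L) (s : Finset ℤ) (u : ℤ → ℂ) (k : ℤ) :
    fourierCoeffOn hL (fun x => ∑ j ∈ s, u j * fourierMode L j x) k = if k ∈ s then u k else 0 := by
  have : fourierCoeffOn hL (fun x => ∑ j ∈ s, u j * fourierMode L j x) k =
      ∑ j ∈ s, u j * fourierCoeffOn hL (fourierMode L j) k := by
    induction s using Finset.induction_on with
    | empty => simp [fourierCoeffOn_eq_integral_fourierMode]
    | insert a s ha ih =>
      simp only [Finset.sum_insert ha]
      rw [fourierCoeffOn_add hL ((memLp_fourierMode L a 2).const_mul (u a))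
        (memLp_sum_fourierMode L s u 2), ih, fourierCoeffOn.const_mul]
  rw [this]
  simp [fourierCoeffOn_fourierMode]

/-- A square-integrable function with summable Fourier coefficients is bounded, almost everywhere,
by the sum of their norms. -/
theorem ae_norm_le_tsum_norm_fourierCoeffOn {L : ℝ} (hL : 0 < L) {f : ℝ → ℂ}
    (hf : MemLp f 2 (volume.restrict (Set.Ioc 0 L)))
    (hs : Summable fun k => ‖fourierCoeffOn hL f k‖) :
    ∀ᵐ x ∂volume.restrict (Set.Ioc 0 L), ‖f x‖ ≤ ∑' k, ‖fourierCoeffOn hL f k‖ := by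
  have hT : Fact (0 < L - 0) := ⟨by simpa using hL⟩
  have hf' : MemLp f 2 (volume.restrict (Set.Ioc 0 (0 + (L - 0)))) := by simpa using hf
  have h := hf'.memLp_liftIoc.haarAddCircle
  have hcoef : ∀ k, fourierCoeff h.toLp k = fourierCoeffOn hL f k := fun k => by
    rw [fourierCoeff_congr_ae h.coeFn_toLp]; rfl
  have hsum := hasSum_fourier_series_L2 h.toLp
  simp only [hcoef] at hsum
  let u : ℤ → C(AddCircle (L - 0), ℂ) := fun k => fourierCoeffOn hL f k • fourier k
  have hun : ∀ k, ‖u k‖ = ‖fourierCoeffOn hL f k‖ := fun k => by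
    simp only [u, norm_smul, fourier_norm, mul_one]
  have hsu : Summable fun k => ‖u k‖ := by simpa only [hun] using hs
  have hsum' := (ContinuousMap.toLp (E := ℂ) 2 (AddCircle.haarAddCircle (T := L - 0)) ℂ).hasSum
    hsu.of_norm.hasSum
  -- The Fourier series converges to `f` in `L²` and, being absolutely summable, also to a
  -- continuous function; limits are unique.
  have heq : h.toLp = ContinuousMap.toLp (E := ℂ) 2 AddCircle.haarAddCircle ℂ (∑' k, u k) := by
    refine hsum.unique ?_
    convert hsum' using 1
    ext1 k
    simp [u]
  have hae : ∀ᵐ z ∂(AddCircle.haarAddCircle (T := L - 0)),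
      ‖AddCircle.liftIoc (L - 0) 0 f z‖ ≤ ∑' k, ‖fourierCoeffOn hL f k‖ := by
    have h1 := h.coeFn_toLp
    rw [heq] at h1
    filter_upwards [h1, ContinuousMap.coeFn_toLp (p := 2) (𝕜 := ℂ)
      (AddCircle.haarAddCircle (T := L - 0)) (∑' k, u k)] with z hz1 hz2
    rw [← hz1, hz2]
    refine ((∑' k, u k).norm_coe_le_norm z).trans ((norm_tsum_le_tsum_norm hsu).trans_eq ?_)
    simp only [hun]
  have hvol : ∀ᵐ z ∂(volume : Measure (AddCircle (L - 0))),
      ‖AddCircle.liftIoc (L - 0) 0 f z‖ ≤ ∑' k, ‖fourierCoeffOn hL f k‖ := by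
    rw [AddCircle.volume_eq_smul_haarAddCircle]
    exact Measure.ae_smul_measure hae _
  have hpull := (AddCircle.measurePreserving_mk (L - 0) 0).quasiMeasurePreserving.ae hvol
  rw [show (0 : ℝ) + (L - 0) = L by ring] at hpull
  filter_upwards [hpull, ae_restrict_mem measurableSet_Ioc] with x hx hxm
  rwa [AddCircle.liftIoc_coe_apply (by simpa using hxm)] at hx

/-! ### Filtered reconstruction error -/

theorem filteredReconstruction_eq_sum {L : ℝ} (hL : 0 < L) (f : ℝ → ℂ) (σ : ℝ → ℝ) (Ω : ℝ) :
    filteredReconstruction hL f σ Ω = fun x =>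
      ∑ k ∈ Finset.Icc (-⌊L * Ω / (2 * Real.pi)⌋) ⌊L * Ω / (2 * Real.pi)⌋,
        (fourierCoeffOn hL f k * (σ (2 * Real.pi / (L * Ω) * k) : ℂ)) * fourierMode L k x := by
  ext x
  unfold filteredReconstruction fourierMode
  refine Finset.sum_congr rfl fun k _ => ?_
  rw [show 2 * Real.pi * k / L / Ω = 2 * Real.pi / (L * Ω) * k by rw [div_div]; ring]

theorem memLp_filteredReconstruction {L : ℝ} (hL : 0 < L) (f : ℝ → ℂ) (σ : ℝ → ℝ) (Ω : ℝ)
    (p : ENNReal) :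
    MemLp (filteredReconstruction hL f σ Ω) p (volume.restrict (Set.Ioc 0 L)) := by
  rw [filteredReconstruction_eq_sum]
  exact memLp_sum_fourierMode L _ _ p

/-- The sharp cutoff is invisible: every discarded index has `|hk| ≥ 1`, where `σ` is zero anyway.
-/
theorem fourierCoeffOn_filteredReconstruction {L : ℝ} (hL : 0 < L) (f : ℝ → ℂ) {σ : ℝ → ℝ}
    (hσ : ∀ η : ℝ, 1 ≤ |η| → σ η = 0) {Ω : ℝ} (hΩ : 0 < Ω) (k : ℤ) :
    fourierCoeffOn hL (filteredReconstruction hL f σ Ω) k =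
      fourierCoeffOn hL f k * (σ (2 * Real.pi / (L * Ω) * k) : ℂ) := by
  rw [filteredReconstruction_eq_sum, fourierCoeffOn_sum_fourierMode, ite_eq_left_iff]
  intro hk
  have hpi := Real.pi_pos
  rw [hσ, Complex.ofReal_zero, mul_zero]
  rw [Finset.mem_Icc, ← abs_le, not_le, Int.floor_lt, Int.cast_abs] at hk
  rw [abs_mul, abs_of_pos (by positivity)]
  calc 1 = 2 * Real.pi / (L * Ω) * (L * Ω / (2 * Real.pi)) := by field_simp
    _ ≤ _ := by gcongr

theorem fourierCoeffOn_sub_filteredReconstruction {L : ℝ} (hL : 0 < L) {f : ℝ → ℂ}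
    (hf : MemLp f 2 (volume.restrict (Set.Ioc 0 L))) {σ : ℝ → ℝ}
    (hσ : ∀ η : ℝ, 1 ≤ |η| → σ η = 0) {Ω : ℝ} (hΩ : 0 < Ω) (k : ℤ) :
    fourierCoeffOn hL (fun x => f x - filteredReconstruction hL f σ Ω x) k =
      ((1 - σ (2 * Real.pi / (L * Ω) * k) : ℝ) : ℂ) * fourierCoeffOn hL f k := by
  rw [fourierCoeffOn_sub hL hf (memLp_filteredReconstruction hL f σ Ω 2),
    fourierCoeffOn_filteredReconstruction hL f hσ hΩ]
  push_cast; ring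

theorem filteredReconstruction_add {L : ℝ} (hL : 0 < L) {f g : ℝ → ℂ}
    (hf : MemLp f 2 (volume.restrict (Set.Ioc 0 L)))
    (hg : MemLp g 2 (volume.restrict (Set.Ioc 0 L))) (σ : ℝ → ℝ) (Ω x : ℝ) :
    filteredReconstruction hL (fun x => f x + g x) σ Ω x =
      filteredReconstruction hL f σ Ω x + filteredReconstruction hL g σ Ω x := by
  simp only [filteredReconstruction, ← Finset.sum_add_distrib, fourierCoeffOn_add hL hf hg]
  exact Finset.sum_congr rfl fun k _ => by ring

theorem filteredReconstruction_const_mul {L : ℝ} (hL : 0 < L) (f : ℝ → ℂ) (c : ℂ) (σ : ℝ → ℝ)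
    (Ω x : ℝ) :
    filteredReconstruction hL (fun x => c * f x) σ Ω x =
      c * filteredReconstruction hL f σ Ω x := by
  simp only [filteredReconstruction, Finset.mul_sum, fourierCoeffOn.const_mul]
  exact Finset.sum_congr rfl fun k _ => by ring

theorem filteredReconstruction_congr_ae {L : ℝ} (hL : 0 < L) {f g : ℝ → ℂ}
    (h : f =ᵐ[volume.restrict (Set.Ioc 0 L)] g) (σ : ℝ → ℝ) (Ω : ℝ) :
    filteredReconstruction hL f σ Ω = filteredReconstruction hL g σ Ω := by
  ext x
  simp only [filteredReconstruction, fourierCoeffOn_congr_ae hL h]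

/-! ### The sawtooth wave -/

/-- The `L`-periodic sawtooth wave, equal to `L / 2 - x` on `[0, L)`. -/
noncomputable def sawtooth (L x : ℝ) : ℂ := ((L / 2 - L * Int.fract (x / L) : ℝ) : ℂ)

theorem sawtooth_of_mem {L : ℝ} (hL : 0 < L) {x : ℝ} (hx : x ∈ Set.Ico 0 L) :
    sawtooth L x = L / 2 - x := by
  rw [sawtooth, Int.fract_eq_self.2 ⟨by have := hx.1; positivity, (div_lt_one hL).2 hx.2⟩,
    mul_div_cancel₀ _ hL.ne']
  push_cast; ring

theorem periodic_sawtooth {L : ℝ} (hL : 0 < L) : Function.Periodic (sawtooth L) L := by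
  intro x
  rw [sawtooth, sawtooth, add_div, div_self hL.ne', Int.fract_add_one]

theorem measurable_sawtooth (L : ℝ) : Measurable (sawtooth L) := by
  unfold sawtooth; fun_prop

theorem memLp_sawtooth {L : ℝ} (hL : 0 < L) (ξ : ℝ) (p : ENNReal) :
    MemLp (fun x => sawtooth L (x - ξ)) p (volume.restrict (Set.Ioc 0 L)) := by
  refine (memLp_const (L : ℂ)).of_le
    ((measurable_sawtooth L).comp (measurable_id.sub_const ξ)).aestronglyMeasurable
    (ae_of_all _ fun x => ?_)
  rw [sawtooth, Complex.norm_real, Complex.norm_real, Real.norm_eq_abs, Real.norm_eq_abs,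
    abs_of_pos hL, abs_le]
  have h1 := Int.fract_nonneg ((x - ξ) / L)
  have h2 := (Int.fract_lt_one ((x - ξ) / L)).le
  constructor <;> nlinarith

theorem integral_fourierMode_mul_sawtooth {L : ℝ} (hL : 0 < L) (k : ℤ) :
    ∫ x in 0..L, fourierMode L (-k) x * sawtooth L x = L * sawtoothCoeff L k := by
  have hcongr : ∫ x in 0..L, fourierMode L (-k) x * sawtooth L x =
      ∫ x in 0..L, fourierMode L (-k) x * ((L : ℂ) / 2 - x) :=
    intervalIntegral.integral_congr_Ioo_of_le hL.le fun x hx => by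
      simp only [sawtooth_of_mem hL (Set.Ioo_subset_Ico_self hx)]
  have hLc : (L : ℂ) ≠ 0 := by exact_mod_cast hL.ne'
  rw [hcongr]
  rcases eq_or_ne k 0 with rfl | hk
  -- The sawtooth has mean zero, in agreement with the value `0⁻¹ = 0` of `sawtoothCoeff L 0`.
  · have hd : ∀ x ∈ Set.uIcc 0 L, HasDerivAt (fun x : ℝ => (L : ℂ) / 2 * x - (x : ℂ) ^ 2 / 2)
        (fourierMode L (-0) x * ((L : ℂ) / 2 - x)) x := by
      intro x _
      have h1 := Complex.ofRealCLM.hasDerivAt (x := x)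
      have := (h1.const_mul ((L : ℂ) / 2)).sub ((h1.pow 2).div_const 2)
      convert! this using 1
      simp only [neg_zero, fourierMode_zero, Complex.ofRealCLM_apply, Complex.ofReal_one]
      push_cast; ring
    rw [intervalIntegral.integral_eq_sub_of_hasDerivAt hd
      (((continuous_fourierMode L _).mul (by fun_prop)).intervalIntegrable _ _)]
    simp [sawtoothCoeff_zero]; ring
  · set w : ℂ := Complex.I * (2 * Real.pi * k / L : ℝ) with hw
    have hw0 : w ≠ 0 := by
      have : (k : ℝ) ≠ 0 := by exact_mod_cast hk
      refine mul_ne_zero Complex.I_ne_zero (Complex.ofReal_ne_zero.2 ?_)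
      have := Real.pi_pos
      positivity
    have hd : ∀ x ∈ Set.uIcc 0 L, HasDerivAt
        (fun x : ℝ => fourierMode L (-k) x * (-((L : ℂ) / 2 - x) / w + 1 / w ^ 2))
        (fourierMode L (-k) x * ((L : ℂ) / 2 - x)) x := by
      intro x _
      have h1 := Complex.ofRealCLM.hasDerivAt (x := x)
      have h2 := (hasDerivAt_fourierMode L (-k) x).mul
        ((((h1.const_sub ((L : ℂ) / 2)).neg).div_const w).add_const (1 / w ^ 2))
      convert! h2 using 1
      have : Complex.I * ((2 * Real.pi * ((-k : ℤ) : ℝ) / L : ℝ) : ℂ) = -w := by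
        rw [hw]; push_cast; ring
      rw [this]
      simp only [Complex.ofRealCLM_apply, Complex.ofReal_one, Pi.neg_apply]
      field_simp
      ring
    rw [intervalIntegral.integral_eq_sub_of_hasDerivAt hd
      (((continuous_fourierMode L _).mul (by fun_prop)).intervalIntegrable _ _)]
    have hm : fourierMode L (-k) L = fourierMode L (-k) 0 := by
      simpa using periodic_fourierMode hL (-k) 0
    rw [hm, show fourierMode L (-k) 0 = 1 by simp [fourierMode], sawtoothCoeff, ← hw]
    push_cast
    field_simp
    ring

theorem fourierCoeffOn_sawtooth {L : ℝ} (hL : 0 < L) (ξ : ℝ) (k : ℤ) :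
    fourierCoeffOn hL (fun x => sawtooth L (x - ξ)) k =
      fourierMode L (-k) ξ * sawtoothCoeff L k := by
  have h1 : ∫ x in 0..L, fourierMode L (-k) x * sawtooth L (x - ξ) =
      ∫ x in 0..L, fourierMode L (-k) ξ *
        (fun u => fourierMode L (-k) u * sawtooth L u) (x - ξ) := by
    congr 1; ext x
    have : fourierMode L (-k) x = fourierMode L (-k) (x - ξ) * fourierMode L (-k) ξ := by
      rw [← fourierMode_add_apply, sub_add_cancel]
    rw [this]; ring
  have hper : Function.Periodic (fun u => fourierMode L (-k) u * sawtooth L u) L :=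
    (periodic_fourierMode hL (-k)).mul (periodic_sawtooth hL)
  have hshift := hper.intervalIntegral_add_eq (0 - ξ) 0
  rw [show 0 - ξ + L = L - ξ by ring, zero_add] at hshift
  rw [fourierCoeffOn_eq_integral_fourierMode, h1, intervalIntegral.integral_const_mul,
    intervalIntegral.integral_comp_sub_right (fun u => fourierMode L (-k) u * sawtooth L u),
    hshift, integral_fourierMode_mul_sawtooth hL]
  have hLc : (L : ℂ) ≠ 0 := by exact_mod_cast hL.ne'
  field_simp

/-! ### Multiplication by `1 - exp (2πi(x - ξ)/L)` -/

theorem MeasureTheory.MemLp.one_sub_fourierMode_mul {L : ℝ} {f : ℝ → ℂ} {p : ENNReal}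
    (hf : MemLp f p (volume.restrict (Set.Ioc 0 L))) (ξ : ℝ) :
    MemLp (fun x => (1 - fourierMode L 1 (x - ξ)) * f x) p (volume.restrict (Set.Ioc 0 L)) := by
  have := hf.sub ((hf.fourierMode_mul 1).const_mul (fourierMode L (-1) ξ))
  convert! this using 1
  ext x
  simp only [Pi.sub_apply, fourierMode_sub_apply]
  ring

/-- Multiplication by a mode shifts indices by one, and centring it at `ξ` exactly compensates the
change of phase, leaving a backward difference of `v`. -/
theorem fourierCoeffOn_one_sub_fourierMode_mul {L : ℝ} (hL : 0 < L) {f : ℝ → ℂ}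
    (hf : MemLp f 2 (volume.restrict (Set.Ioc 0 L))) {ξ : ℝ} {v : ℤ → ℂ}
    (hv : ∀ k, fourierCoeffOn hL f k = fourierMode L (-k) ξ * v k) (k : ℤ) :
    fourierCoeffOn hL (fun x => (1 - fourierMode L 1 (x - ξ)) * f x) k =
      fourierMode L (-k) ξ * (v k - v (k - 1)) := by
  have e : (fun x => (1 - fourierMode L 1 (x - ξ)) * f x) =
      fun x => f x - fourierMode L (-1) ξ * (fourierMode L 1 x * f x) := by
    ext x
    simp only [fourierMode_sub_apply]
    ring
  rw [e, fourierCoeffOn_sub hL hf ((hf.fourierMode_mul 1).const_mul _), fourierCoeffOn.const_mul,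
    fourierCoeffOn_fourierMode_mul, hv, hv, ← mul_assoc, ← fourierMode_add,
    show -1 + -(k - 1) = -k by ring]
  ring

/-! ### Error of the filtered reconstruction of a sawtooth wave -/

theorem sum_Icc_neg_eq_sum_range {g : ℤ → ℝ} (h0 : g 0 = 0) (K : ℕ) :
    ∑ k ∈ Finset.Icc (-(K : ℤ)) K, g k =
      ∑ n ∈ Finset.range K, g (n + 1) + ∑ n ∈ Finset.range K, g (-(n + 1)) := by
  induction K with
  | zero => simp [h0]
  | succ K ih =>
    have e : Finset.Icc (-((K + 1 : ℕ) : ℤ)) ((K + 1 : ℕ) : ℤ) =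
        insert (-((K : ℤ) + 1)) (insert ((K : ℤ) + 1) (Finset.Icc (-(K : ℤ)) K)) := by
      ext k
      simp only [Finset.mem_Icc, Finset.mem_insert]
      omega
    rw [e, Finset.sum_insert, Finset.sum_insert, ih, Finset.sum_range_succ, Finset.sum_range_succ]
    · ring
    · simp
    · simp only [Finset.mem_Icc, Finset.mem_insert]; omega

theorem fourierCoeffOn_sawtooth_sub_filteredReconstruction {L : ℝ} (hL : 0 < L) {σ : ℝ → ℝ}
    (hσ : ∀ η : ℝ, 1 ≤ |η| → σ η = 0) {Ω : ℝ} (hΩ : 0 < Ω) (ξ : ℝ) (k : ℤ) :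
    fourierCoeffOn hL (fun x => sawtooth L (x - ξ) -
        filteredReconstruction hL (fun x => sawtooth L (x - ξ)) σ Ω x) k =
      fourierMode L (-k) ξ * sawtoothErrorCoeff L σ (2 * Real.pi / (L * Ω)) k := by
  rw [fourierCoeffOn_sub_filteredReconstruction hL (memLp_sawtooth hL ξ 2) hσ hΩ,
    fourierCoeffOn_sawtooth, sawtoothErrorCoeff]
  ring

theorem FilterBound.sum_Icc_norm_sawtoothErrorCoeff_le {L : ℝ} (hL : 0 < L) {σ : ℝ → ℝ} {M : ℝ}
    (hσ : FilterBound σ 1 M) {h θ : ℝ} (hh : 0 < h) (h0 : 0 < θ) (h1 : θ < 1) (K : ℕ) :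
    ∑ k ∈ Finset.Icc (-(K : ℤ)) K, ‖sawtoothErrorCoeff L σ h k‖ ≤
      2 / θ * (L / Real.pi * M * h ^ θ) * (K : ℝ) ^ θ := by
  have hpi := Real.pi_pos
  have hM := hσ.nonneg
  rw [sum_Icc_neg_eq_sum_range (by simp [sawtoothErrorCoeff_zero])]
  set A := L / Real.pi * M * h ^ θ
  have hA : 0 ≤ A := by positivity
  have hs : ∀ ε : ℤ, ε = 1 ∨ ε = -1 →
      ∑ n ∈ Finset.range K, ‖sawtoothErrorCoeff L σ h (ε * (n + 1))‖ ≤ A * ((K : ℝ) ^ θ / θ) := by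
    intro ε hε
    refine le_trans ?_ (mul_le_mul_of_nonneg_left (sum_range_rpow_sub_one_le h0 h1.le K) hA)
    rw [Finset.mul_sum]
    refine Finset.sum_le_sum fun n _ => ?_
    have hne : ε * ((n : ℤ) + 1) ≠ 0 := by rcases hε with rfl | rfl <;> omega
    refine (hσ.norm_sawtoothErrorCoeff_le hL hh h0.le h1.le hne).trans_eq ?_
    have : |((ε * ((n : ℤ) + 1) : ℤ) : ℝ)| = (n : ℝ) + 1 := by
      push_cast
      rw [abs_mul, abs_of_pos (by positivity : (0 : ℝ) < (n : ℝ) + 1)]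
      rcases hε with rfl | rfl <;> simp
    rw [this]
  have s1 := hs 1 (Or.inl rfl)
  have s2 := hs (-1) (Or.inr rfl)
  simp only [one_mul, neg_mul] at s1 s2
  calc _ ≤ A * ((K : ℝ) ^ θ / θ) + A * ((K : ℝ) ^ θ / θ) := add_le_add s1 s2
    _ = _ := by ring

/-- High-frequency half of the splitting: after multiplication by `1 - exp(2πi(x-ξ)/L)`, the tail is
controlled by the total variation of its coefficients. -/
theorem FilterBound.tsum_norm_truncate_sub_le {L : ℝ} (hL : 0 < L) {σ : ℝ → ℝ} {M : ℝ}
    (hσ : FilterBound σ 1 M) {h θ : ℝ} (hh : 0 < h) (h0 : 0 < θ) (h1 : θ < 1) {K : ℕ}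
    (hK : 1 ≤ K) {v : ℤ → ℂ}
    (hv : ∀ k, v k = if k ∈ Finset.Icc (-(K : ℤ)) K then 0 else sawtoothErrorCoeff L σ h k) :
    (Summable fun k => ‖v k - v (k - 1)‖) ∧
      ∑' k, ‖v k - v (k - 1)‖ ≤
        2 * ((2 / (1 - θ) + 1) * (L / Real.pi * M * h ^ θ) * (K : ℝ) ^ (θ - 1)) := by
  have hpi := Real.pi_pos
  have hM := hσ.nonneg
  have hA : 0 ≤ L / Real.pi * M * h ^ θ := by positivity
  have key : ∀ ε : ℤ, ε = 1 ∨ ε = -1 → ∀ N : ℕ,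
      ∑ n ∈ Finset.range N, ‖v (ε * (n + 1)) - v (ε * n)‖ ≤
        (2 / (1 - θ) + 1) * (L / Real.pi * M * h ^ θ) * (K : ℝ) ^ (θ - 1) := by
    intro ε hε N
    have hve : ∀ n : ℕ, v (ε * n) = if n ≤ K then 0 else sawtoothErrorCoeff L σ h (ε * n) := by
      intro n
      rw [hv]
      refine if_congr ?_ rfl rfl
      rw [Finset.mem_Icc]
      rcases hε with rfl | rfl <;> omega
    have := sum_range_norm_sub_truncate_le h0 h1 hA (b := fun n => sawtoothErrorCoeff L σ h (ε * n))
      (fun n hn => ?_) (fun n hn => ?_) hK N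
    · refine (Finset.sum_le_sum fun n _ => ?_).trans this
      have h1 := hve (n + 1)
      push_cast at h1
      rw [h1, hve n]
      push_cast
      exact le_rfl
    · have hne : ε * (n : ℤ) ≠ 0 := by rcases hε with rfl | rfl <;> omega
      refine (hσ.norm_sawtoothErrorCoeff_le hL hh h0.le h1.le hne).trans_eq ?_
      have : |((ε * (n : ℤ) : ℤ) : ℝ)| = (n : ℝ) := by
        push_cast
        rw [abs_mul, Nat.abs_cast]
        rcases hε with rfl | rfl <;> simp
      rw [this]
    · have := hσ.norm_sawtoothErrorCoeff_sub_le hL hh h0.le h1.le (by linarith) hn hε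
      simpa using this
  refine Int.summable_and_tsum_le_of_sum_range_le (fun k => norm_nonneg _) (fun N => ?_) fun N => ?_
  · simpa using key 1 (Or.inl rfl) N
  · refine (Finset.sum_le_sum fun n _ => ?_).trans (key (-1) (Or.inr rfl) N)
    rw [norm_sub_rev, show (-1 : ℤ) * (n + 1) = -n - 1 by ring, neg_one_mul]

/-- Pointwise decay of the error away from the jump. -/
theorem FilterBound.exists_ae_norm_sawtooth_sub_le {L : ℝ} (hL : 0 < L) {σ : ℝ → ℝ} {M : ℝ}
    (hσ : FilterBound σ 1 M) (hz : ∀ η : ℝ, 1 ≤ |η| → σ η = 0) {θ : ℝ} (h0 : 0 < θ) (h1 : θ < 1) :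
    ∃ C : ℝ, 0 ≤ C ∧ ∀ Ω : ℝ, 0 < Ω → ∀ ξ : ℝ, ∀ᵐ x ∂volume.restrict (Set.Ioc 0 L),
      ‖1 - fourierMode L 1 (x - ξ)‖ ^ θ * ‖sawtooth L (x - ξ) -
        filteredReconstruction hL (fun x => sawtooth L (x - ξ)) σ Ω x‖ ≤
          C * (2 * Real.pi / (L * Ω)) ^ θ := by
  have hpi := Real.pi_pos
  have hM := hσ.nonneg
  have h1' : 0 < 1 - θ := by linarith
  refine ⟨(8 / θ + 2 * (2 / (1 - θ) + 1)) * (L / Real.pi * M), by positivity, fun Ω hΩ ξ => ?_⟩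
  set h := 2 * Real.pi / (L * Ω) with hh_def
  have hh : 0 < h := by positivity
  set A := L / Real.pi * M * h ^ θ with hA_def
  have hA : 0 ≤ A := by positivity
  set E : ℝ → ℂ := fun x => sawtooth L (x - ξ) -
    filteredReconstruction hL (fun x => sawtooth L (x - ξ)) σ Ω x with hE
  have hEm : MemLp E 2 (volume.restrict (Set.Ioc 0 L)) :=
    (memLp_sawtooth hL ξ 2).sub (memLp_filteredReconstruction hL _ σ Ω 2)
  -- One null set must serve all `K`, since `K` is later chosen depending on `x`.
  have hae : ∀ᵐ x ∂volume.restrict (Set.Ioc 0 L), ∀ K : ℕ, 1 ≤ K →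
      ‖1 - fourierMode L 1 (x - ξ)‖ * (‖E x‖ - 2 / θ * A * (K : ℝ) ^ θ) ≤
        2 * ((2 / (1 - θ) + 1) * A * (K : ℝ) ^ (θ - 1)) := by
    rw [ae_all_iff]
    intro K
    by_cases hK : 1 ≤ K
    swap
    · exact ae_of_all _ fun x h => absurd h hK
    let low : ℝ → ℂ := fun x => ∑ k ∈ Finset.Icc (-(K : ℤ)) K,
      (fourierMode L (-k) ξ * sawtoothErrorCoeff L σ h k) * fourierMode L k x
    have hlow : ∀ x, ‖low x‖ ≤ 2 / θ * A * (K : ℝ) ^ θ := fun x => by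
      refine (norm_sum_le _ _).trans ?_
      simpa [norm_fourierMode] using hσ.sum_Icc_norm_sawtoothErrorCoeff_le hL hh h0 h1 K
    let v : ℤ → ℂ := fun k =>
      if k ∈ Finset.Icc (-(K : ℤ)) K then 0 else sawtoothErrorCoeff L σ h k
    obtain ⟨hs, ht⟩ := hσ.tsum_norm_truncate_sub_le hL hh h0 h1 hK (v := v) fun k => rfl
    have hlm : MemLp low 2 (volume.restrict (Set.Ioc 0 L)) := memLp_sum_fourierMode L _ _ 2
    have hfm : MemLp (fun x => E x - low x) 2 (volume.restrict (Set.Ioc 0 L)) := hEm.sub hlm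
    have hcoef : ∀ k, fourierCoeffOn hL (fun x => E x - low x) k = fourierMode L (-k) ξ * v k := by
      intro k
      rw [fourierCoeffOn_sub hL hEm hlm, hE,
        fourierCoeffOn_sawtooth_sub_filteredReconstruction hL hz hΩ, fourierCoeffOn_sum_fourierMode]
      simp only [v]
      split_ifs <;> simp [← hh_def]
    have hd : ∀ k, ‖fourierCoeffOn hL (fun x => (1 - fourierMode L 1 (x - ξ)) * (E x - low x)) k‖ =
        ‖v k - v (k - 1)‖ := fun k => by
      rw [fourierCoeffOn_one_sub_fourierMode_mul hL hfm hcoef, norm_mul, norm_fourierMode, one_mul]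
    have := ae_norm_le_tsum_norm_fourierCoeffOn hL (hfm.one_sub_fourierMode_mul ξ)
      (by simpa only [hd] using hs)
    simp only [hd] at this
    filter_upwards [this] with x hx _
    refine le_trans ?_ (hx.trans ht)
    rw [norm_mul]
    gcongr
    have := norm_sub_norm_le (E x) (low x)
    linarith [hlow x]
  filter_upwards [hae] with x hx
  change ‖1 - fourierMode L 1 (x - ξ)‖ ^ θ * ‖E x‖ ≤ _
  have hw2 : ‖1 - fourierMode L 1 (x - ξ)‖ ≤ 2 := by
    refine (norm_sub_le _ _).trans ?_
    rw [norm_fourierMode]; norm_num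
  set w := ‖1 - fourierMode L 1 (x - ξ)‖
  have hw0 : 0 ≤ w := norm_nonneg _
  rcases hw0.eq_or_lt with hw | hw
  · rw [← hw, Real.zero_rpow h0.ne', zero_mul]; positivity
  -- The choice `K = ⌈2/w⌉` balances low and high frequencies; `w ≤ 2` keeps rounding up harmless,
  -- so that `2 ≤ wK ≤ 4`.
  have hK1 : 1 ≤ ⌈2 / w⌉₊ := Nat.one_le_iff_ne_zero.2 (Nat.ceil_pos.2 (by positivity)).ne'
  have hb := hx ⌈2 / w⌉₊ hK1
  have hKl : 2 / w ≤ (⌈2 / w⌉₊ : ℝ) := Nat.le_ceil _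
  have hKu : (⌈2 / w⌉₊ : ℝ) ≤ 4 / w := by
    have h3 := (Nat.ceil_lt_add_one (by positivity : 0 ≤ 2 / w)).le
    have h4 : 1 ≤ 2 / w := by rwa [le_div_iff₀ hw, one_mul]
    have : 4 / w = 2 / w + 2 / w := by ring
    linarith
  set K : ℝ := (⌈2 / w⌉₊ : ℝ)
  have hKpos : 0 < K := lt_of_lt_of_le (by positivity) hKl
  have k1 : w ^ θ * K ^ θ ≤ 4 := by
    rw [← Real.mul_rpow hw.le hKpos.le]
    have : w * K ≤ 4 := by rw [mul_comm]; exact (le_div_iff₀ hw).1 hKu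
    calc (w * K) ^ θ ≤ 4 ^ θ := by gcongr
      _ ≤ 4 ^ (1 : ℝ) := Real.rpow_le_rpow_of_exponent_le (by norm_num) h1.le
      _ = 4 := Real.rpow_one 4
  have k2 : w ^ (θ - 1) * K ^ (θ - 1) ≤ 1 := by
    rw [← Real.mul_rpow hw.le hKpos.le]
    have : 2 ≤ w * K := by rw [mul_comm]; exact (div_le_iff₀ hw).1 hKl
    exact Real.rpow_le_one_of_one_le_of_nonpos (by linarith) (by linarith)
  have ew : w ^ θ = w * w ^ (θ - 1) := by rw [Real.rpow_sub_one hw.ne']; field_simp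
  have hwp : 0 < w ^ (θ - 1) := by positivity
  calc w ^ θ * ‖E x‖ = w ^ (θ - 1) * (w * (‖E x‖ - 2 / θ * A * K ^ θ)) +
        2 / θ * A * (w ^ θ * K ^ θ) := by rw [ew]; ring
    _ ≤ w ^ (θ - 1) * (2 * ((2 / (1 - θ) + 1) * A * K ^ (θ - 1))) + 2 / θ * A * 4 := by gcongr
    _ = 2 * (2 / (1 - θ) + 1) * A * (w ^ (θ - 1) * K ^ (θ - 1)) + 8 / θ * A := by ring
    _ ≤ 2 * (2 / (1 - θ) + 1) * A * 1 + 8 / θ * A := by gcongr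
    _ = _ := by rw [hA_def]; ring

/-- Weighted mean square estimates of the error. -/
theorem FilterBound.exists_integral_sq_sawtooth_sub_le {L : ℝ} (hL : 0 < L) {σ : ℝ → ℝ} {M : ℝ}
    (hσ : FilterBound σ 2 M) (hz : ∀ η : ℝ, 1 ≤ |η| → σ η = 0) :
    ∃ C : ℝ, 0 ≤ C ∧ ∀ Ω : ℝ, 0 < Ω → ∀ ξ : ℝ,
      ∫ x in 0..L, ‖sawtooth L (x - ξ) -
        filteredReconstruction hL (fun x => sawtooth L (x - ξ)) σ Ω x‖ ^ 2 ≤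
          C * (2 * Real.pi / (L * Ω)) ∧
      ∫ x in 0..L, ‖(1 - fourierMode L 1 (x - ξ)) * (sawtooth L (x - ξ) -
        filteredReconstruction hL (fun x => sawtooth L (x - ξ)) σ Ω x)‖ ^ 2 ≤
          C * (2 * Real.pi / (L * Ω)) ^ 3 := by
  have hpi := Real.pi_pos
  have hM := hσ.nonneg
  set D := L / Real.pi * M with hD_def
  have hD : 0 ≤ D := by positivity
  refine ⟨L * (128 * D ^ 2), by positivity, fun Ω hΩ ξ => ?_⟩
  set h := 2 * Real.pi / (L * Ω) with hh_def
  have hh : 0 < h := by positivity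
  set E : ℝ → ℂ := fun x => sawtooth L (x - ξ) -
    filteredReconstruction hL (fun x => sawtooth L (x - ξ)) σ Ω x with hE
  have hEm : MemLp E 2 (volume.restrict (Set.Ioc 0 L)) :=
    (memLp_sawtooth hL ξ 2).sub (memLp_filteredReconstruction hL _ σ Ω 2)
  set c := sawtoothErrorCoeff L σ h with hc
  have hcoef : ∀ k, fourierCoeffOn hL E k = fourierMode L (-k) ξ * c k :=
    fourierCoeffOn_sawtooth_sub_filteredReconstruction hL hz hΩ ξ
  have hck : ∀ θ : ℝ, 0 ≤ θ → θ ≤ 2 → ∀ k : ℤ, k ≠ 0 → ‖c k‖ ≤ D * h ^ θ * |(k : ℝ)| ^ (θ - 1) :=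
    fun θ h0 h2 k hk => hσ.norm_sawtoothErrorCoeff_le hL hh h0 h2 hk
  have parseval : ∀ f : ℝ → ℂ, MemLp f 2 (volume.restrict (Set.Ioc 0 L)) →
      ∀ u : ℤ → ℝ, ∀ B, (∀ k, ‖fourierCoeffOn hL f k‖ = u k) → ∑' k, u k ^ 2 ≤ B →
      ∫ x in 0..L, ‖f x‖ ^ 2 ≤ L * B := by
    intro f hf u B hu hB
    have := tsum_sq_fourierCoeffOn hL hf
    simp only [hu, sub_zero, smul_eq_mul] at this
    rw [this, inv_mul_le_iff₀ hL] at hB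
    exact hB
  constructor
  -- The exponents `θ = 1` and `θ = 0` give the two entries of the minimum.
  · have hb : ∀ k, ‖c k‖ ^ 2 ≤ D ^ 2 * min (h ^ 2) (1 / (k : ℝ) ^ 2) := by
      intro k
      rcases eq_or_ne k 0 with rfl | hk
      · rw [hc, sawtoothErrorCoeff_zero, norm_zero, zero_pow two_ne_zero]; positivity
      · have b1 := hck 1 (by norm_num) (by norm_num) k hk
        have b0 := hck 0 le_rfl (by norm_num) k hk
        simp only [Real.rpow_one, sub_self, Real.rpow_zero, mul_one] at b1
        simp only [Real.rpow_zero, mul_one, zero_sub, Real.rpow_neg_one] at b0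
        rw [mul_min_of_nonneg _ _ (sq_nonneg D)]
        refine le_min ?_ ?_
        · rw [← mul_pow]; gcongr
        · rw [one_div, ← sq_abs (k : ℝ), ← inv_pow, ← mul_pow]; gcongr
    obtain ⟨hs, ht⟩ := summable_and_tsum_min_sq_le hh
    have hs' := hs.mul_left (D ^ 2)
    refine (parseval E hEm (fun k => ‖c k‖) (D ^ 2 * (8 * h)) (fun k => ?_) ?_).trans ?_
    · rw [hcoef, norm_mul, norm_fourierMode, one_mul]
    · refine ((hs'.of_nonneg_of_le (fun k => sq_nonneg _) hb).tsum_le_tsum hb hs').trans ?_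
      rw [tsum_mul_left]
      gcongr
    · have : 0 ≤ L * D ^ 2 * h := by positivity
      linarith
  · have key : ∀ ε : ℤ, ε = 1 ∨ ε = -1 → ∀ N : ℕ,
        ∑ n ∈ Finset.range N, ‖c (ε * (n + 1)) - c (ε * n)‖ ^ 2 ≤ 64 * D ^ 2 * h ^ 3 := by
      intro ε hε N
      -- Now `θ = 2` and `θ = 0`, with `4` from `(n+1)² ≤ 4n²`. For `n = 0` the difference is `c ε`
      -- itself, so the size bound is used. After squaring, one minimum is bounded by `h²` and the
      -- other is summed to `4h`.
      have hb : ∀ n : ℕ, ‖c (ε * (n + 1)) - c (ε * n)‖ ≤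
          4 * D * min (h ^ 2) (1 / ((n : ℝ) + 1) ^ 2) := by
        intro n
        rw [mul_min_of_nonneg _ _ (by positivity)]
        rcases Nat.eq_zero_or_pos n with rfl | hn
        · have hε0 : ε ≠ 0 := by rcases hε with rfl | rfl <;> norm_num
          have hεa : |(ε : ℝ)| = 1 := by rcases hε with rfl | rfl <;> norm_num
          have b2 := hck 2 (by norm_num) le_rfl ε hε0
          have b0 := hck 0 le_rfl (by norm_num) ε hε0
          rw [hεa, Real.one_rpow, mul_one] at b2 b0
          have hc0 : c 0 = 0 := sawtoothErrorCoeff_zero L σ h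
          simp only [CharP.cast_eq_zero, zero_add, mul_one, mul_zero, hc0, sub_zero]
          rw [Real.rpow_zero, mul_one] at b0
          rw [Real.rpow_two] at b2
          have : 0 ≤ D * h ^ 2 := by positivity
          refine le_min ?_ ?_
          · linarith
          · norm_num; linarith
        · have hn' : (1 : ℝ) ≤ n := by exact_mod_cast hn
          have b2 := hσ.norm_sawtoothErrorCoeff_sub_le hL hh (θ := 2) (by norm_num) le_rfl le_rfl
            hn hε
          have b0 := hσ.norm_sawtoothErrorCoeff_sub_le hL hh (θ := 0) le_rfl (by norm_num)
            (by norm_num) hn hε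
          rw [← hD_def, sub_self, Real.rpow_zero, mul_one, Real.rpow_two] at b2
          rw [← hD_def, Real.rpow_zero, mul_one, zero_sub, Real.rpow_neg (by positivity),
            Real.rpow_two] at b0
          have : 0 ≤ D * h ^ 2 := by positivity
          refine le_min (by linarith) (b0.trans ((mul_le_mul_of_nonneg_left
            (c := 4 * (1 / ((n : ℝ) + 1) ^ 2)) ?_ hD).trans_eq (by ring)))
          rw [← one_div, mul_one_div, div_le_div_iff₀ (by positivity) (by positivity)]
          nlinarith
      calc _ ≤ ∑ n ∈ Finset.range N, 16 * D ^ 2 * h ^ 2 * min (h ^ 2) (1 / ((n : ℝ) + 1) ^ 2) := by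
            refine Finset.sum_le_sum fun n _ => ?_
            have hm : 0 ≤ min (h ^ 2) (1 / ((n : ℝ) + 1) ^ 2) := by positivity
            calc _ ≤ (4 * D * min (h ^ 2) (1 / ((n : ℝ) + 1) ^ 2)) ^ 2 := by
                  gcongr; exact hb n
              _ = 16 * D ^ 2 * min (h ^ 2) (1 / ((n : ℝ) + 1) ^ 2) *
                  min (h ^ 2) (1 / ((n : ℝ) + 1) ^ 2) := by ring
              _ ≤ _ := by gcongr; exact min_le_left _ _
        _ ≤ 16 * D ^ 2 * h ^ 2 * (4 * h) := by
            rw [← Finset.mul_sum]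
            gcongr
            exact sum_range_min_sq_le hh N
        _ = _ := by ring
    obtain ⟨hs, ht⟩ := Int.summable_and_tsum_le_of_sum_range_le
      (g := fun k : ℤ => ‖c k - c (k - 1)‖ ^ 2) (fun k => sq_nonneg _)
      (fun N => by simpa using key 1 (Or.inl rfl) N)
      (fun N => (Finset.sum_le_sum fun n _ => by
        rw [norm_sub_rev, show (-1 : ℤ) * (n + 1) = -n - 1 by ring, neg_one_mul]).trans
          (key (-1) (Or.inr rfl) N))
    refine (parseval _ (hEm.one_sub_fourierMode_mul ξ) (fun k => ‖c k - c (k - 1)‖) _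
      (fun k => ?_) ht).trans ?_
    · rw [fourierCoeffOn_one_sub_fourierMode_mul hL hEm hcoef, norm_mul, norm_fourierMode, one_mul]
    · exact le_of_eq (by ring)

/-! ### Integration of the pointwise bounds -/

theorem integrable_min_abs_rpow {α β : ℝ} (hα : α < 1) (hβ : 1 < β) :
    Integrable fun t : ℝ => min (|t| ^ (-α)) (|t| ^ (-β)) := by
  have hm : Measurable fun t : ℝ => min (|t| ^ (-α)) (|t| ^ (-β)) := by fun_prop
  have hle : ∀ t : ℝ, 0 ≤ min (|t| ^ (-α)) (|t| ^ (-β)) := fun t => by positivity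
  have hIoc : IntegrableOn (fun t : ℝ => min (|t| ^ (-α)) (|t| ^ (-β))) (Set.Ioc 0 1) := by
    have h := (intervalIntegrable_iff_integrableOn_Ioc_of_le zero_le_one).1
      (intervalIntegral.intervalIntegrable_rpow' (a := 0) (b := 1) (r := -α) (by linarith))
    refine h.mono' hm.aestronglyMeasurable ((ae_restrict_mem measurableSet_Ioc).mono fun t ht => ?_)
    rw [Real.norm_of_nonneg (hle t), abs_of_pos ht.1]
    exact min_le_left _ _
  have hIoi1 : IntegrableOn (fun t : ℝ => min (|t| ^ (-α)) (|t| ^ (-β))) (Set.Ioi 1) := by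
    have h := integrableOn_Ioi_rpow_of_lt (a := -β) (c := 1) (by linarith) one_pos
    refine h.mono' hm.aestronglyMeasurable ((ae_restrict_mem measurableSet_Ioi).mono fun t ht => ?_)
    rw [Real.norm_of_nonneg (hle t), abs_of_pos (zero_lt_one.trans ht)]
    exact min_le_right _ _
  have hIoi : IntegrableOn (fun t : ℝ => min (|t| ^ (-α)) (|t| ^ (-β))) (Set.Ioi 0) := by
    rw [← Set.Ioc_union_Ioi_eq_Ioi (zero_le_one' ℝ)]
    exact hIoc.union hIoi1
  have hIic : IntegrableOn (fun t : ℝ => min (|t| ^ (-α)) (|t| ^ (-β))) (Set.Iic 0) := by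
    rw [← Measure.map_neg_eq_self (volume : Measure ℝ)]
    let m : MeasurableEmbedding fun x : ℝ => -x := (Homeomorph.neg ℝ).measurableEmbedding
    rw [m.integrableOn_map_iff]
    simp_rw [Function.comp_def, abs_neg, Set.neg_preimage, Set.neg_Iic, neg_zero]
    exact Iff.mpr integrableOn_Ici_iff_integrableOn_Ioi hIoi
  rw [← integrableOn_univ, ← Set.Iic_union_Ioi (a := (0 : ℝ))]
  exact hIic.union hIoi

/-- The right side is `2|sin(πt/L)|`, so this is Jordan's inequality. -/
theorem mul_abs_le_norm_one_sub_fourierMode {L : ℝ} (hL : 0 < L) {t : ℝ} (ht : |t| ≤ L / 2) :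
    4 / L * |t| ≤ ‖1 - fourierMode L 1 t‖ := by
  have hpi := Real.pi_pos
  have e : fourierMode L 1 t = Complex.exp (Complex.I * ((2 * Real.pi * t / L : ℝ) : ℂ)) := by
    rw [fourierMode]; congr 1; push_cast; ring
  rw [norm_sub_rev, e, Complex.norm_exp_I_mul_ofReal_sub_one, norm_mul, Real.norm_eq_abs,
    Real.norm_eq_abs, abs_two]
  have e2 : 2 * Real.pi * t / L / 2 = Real.pi / L * t := by ring
  have e3 : |Real.pi / L * t| = Real.pi / L * |t| := by
    rw [abs_mul, abs_of_pos (by positivity)]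
  have hle : |Real.pi / L * t| ≤ Real.pi / 2 := by
    rw [e3]
    calc Real.pi / L * |t| ≤ Real.pi / L * (L / 2) := by gcongr
      _ = _ := by field_simp
  have := Real.mul_abs_le_abs_sin hle
  rw [e2]
  rw [e3] at this
  calc 4 / L * |t| = 2 * (2 / Real.pi * (Real.pi / L * |t|)) := by field_simp; ring
    _ ≤ _ := by gcongr

theorem exists_mul_abs_le_norm_one_sub_fourierMode {L : ℝ} (hL : 0 < L) {t : ℝ} (ht : |t| ≤ L) :
    ∃ m ∈ ({-L, 0, L} : Finset ℝ), 4 / L * |t - m| ≤ ‖1 - fourierMode L 1 t‖ := by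
  have hper := periodic_fourierMode hL 1
  rw [abs_le] at ht
  rcases lt_or_ge t (-(L / 2)) with h1 | h1
  · refine ⟨-L, by simp, ?_⟩
    rw [← hper t, ← sub_neg_eq_add]
    exact mul_abs_le_norm_one_sub_fourierMode hL (abs_le.2 ⟨by linarith, by linarith⟩)
  rcases le_or_gt t (L / 2) with h2 | h2
  · refine ⟨0, by simp, ?_⟩
    rw [sub_zero]
    exact mul_abs_le_norm_one_sub_fourierMode hL (abs_le.2 ⟨h1, h2⟩)
  · refine ⟨L, by simp, ?_⟩
    rw [← hper.sub_eq t]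
    exact mul_abs_le_norm_one_sub_fourierMode hL (abs_le.2 ⟨by linarith, by linarith⟩)

/-- As `|x - ξ| ≤ L`, the nearest point of `ξ + Lℤ` is one of three. The bound is thus dominated by
three translates of one integrable profile, dilated to width of order `h`, with total integral
`O(h)`. -/
theorem exists_lintegral_le_of_le_min_rpow {L : ℝ} (hL : 0 < L) {α β : ℝ} (hα0 : 0 ≤ α)
    (hα : α < 1) (hβ : 1 < β) :
    ∃ C : ℝ, 0 ≤ C ∧ ∀ h : ℝ, 0 < h → ∀ ξ ∈ Set.Icc 0 L, ∀ B : ℝ, 0 ≤ B → ∀ f : ℝ → ℝ,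
      (∀ᵐ x ∂volume.restrict (Set.Ioc 0 L), 0 < ‖1 - fourierMode L 1 (x - ξ)‖ →
        f x ≤ B * min ((‖1 - fourierMode L 1 (x - ξ)‖ / h) ^ (-α))
          ((‖1 - fourierMode L 1 (x - ξ)‖ / h) ^ (-β))) →
      ∫⁻ x in Set.Ioc 0 L, ENNReal.ofReal (f x) ≤ ENNReal.ofReal (B * (C * h)) := by
  set g : ℝ → ℝ := fun t => min (|t| ^ (-α)) (|t| ^ (-β)) with hg
  have hgi : Integrable g := integrable_min_abs_rpow hα hβ
  have hg0 : ∀ t, 0 ≤ g t := fun t => by positivity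
  set s : Finset ℝ := {-L, 0, L} with hs
  refine ⟨s.card * (L / 4 * ∫ t, g t), mul_nonneg (by positivity)
    (mul_nonneg (by positivity) (integral_nonneg fun t => hg0 t)), fun h hh ξ hξ B hB f hf => ?_⟩
  set R : ℝ := 4 / (L * h) with hR
  have hR0 : 0 < R := by positivity
  let H : ℝ → ℝ := fun x => ∑ m ∈ s, g (R * (x - (ξ + m)))
  have hint : ∀ m ∈ s, Integrable fun x => g (R * (x - (ξ + m))) := fun m _ =>
    (hgi.comp_mul_left' hR0.ne').comp_sub_right (ξ + m)
  have hHi : Integrable H := integrable_finsetSum s hint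
  have hHint : ∫ x, H x = s.card * (L / 4 * ∫ t, g t) * h := by
    rw [integral_finsetSum s hint, Finset.sum_congr rfl fun m _ =>
      integral_sub_right_eq_self (fun x => g (R * x)) (ξ + m), Finset.sum_const, nsmul_eq_mul,
      Measure.integral_comp_mul_left, smul_eq_mul, abs_of_pos (inv_pos.2 hR0), hR, inv_div]
    ring
  have hH0 : ∀ x, 0 ≤ H x := fun x => Finset.sum_nonneg fun m _ => hg0 _
  have hanti : ∀ u v : ℝ, 0 < |u| → |u| ≤ v → min (v ^ (-α)) (v ^ (-β)) ≤ g u := by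
    intro u v hu huv
    exact min_le_min (Real.rpow_le_rpow_of_nonpos hu huv (by linarith))
      (Real.rpow_le_rpow_of_nonpos hu huv (by linarith))
  -- At these centres the profile takes the default value of `0 ^ (-β)`, so monotonicity fails
  -- there.
  have hne : ∀ᵐ x ∂volume.restrict (Set.Ioc 0 L), ∀ m ∈ s, x ≠ ξ + m := by
    rw [Filter.eventually_all_finset]
    intro m _
    exact ae_restrict_of_ae (Measure.ae_ne volume (ξ + m))
  have hle : ∀ᵐ x ∂volume.restrict (Set.Ioc 0 L), f x ≤ B * H x := by
    filter_upwards [hf, hne, ae_restrict_mem measurableSet_Ioc] with x hx hxne hxm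
    have hxξ : |x - ξ| ≤ L := abs_le.2 ⟨by linarith [hxm.1, hξ.2], by linarith [hxm.2, hξ.1]⟩
    obtain ⟨m, hm, hmle⟩ := exists_mul_abs_le_norm_one_sub_fourierMode hL hxξ
    have hpos : 0 < |x - ξ - m| := abs_pos.2 fun h0 => hxne m hm (by linarith)
    have hw : 0 < ‖1 - fourierMode L 1 (x - ξ)‖ := lt_of_lt_of_le (by positivity) hmle
    refine (hx hw).trans (mul_le_mul_of_nonneg_left ?_ hB)
    have hRe : |R * (x - (ξ + m))| = 4 / L * |x - ξ - m| / h := by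
      rw [abs_mul, abs_of_pos hR0, hR, ← sub_sub, ← div_div]; ring
    refine (hanti (R * (x - (ξ + m))) _ ?_ ?_).trans
      (Finset.single_le_sum (f := fun m => g (R * (x - (ξ + m)))) (fun m _ => hg0 _) hm)
    · rw [hRe]; positivity
    · rw [hRe]; gcongr
  calc ∫⁻ x in Set.Ioc 0 L, ENNReal.ofReal (f x)
      ≤ ∫⁻ x in Set.Ioc 0 L, ENNReal.ofReal (B * H x) :=
        lintegral_mono_ae (hle.mono fun x hx => ENNReal.ofReal_le_ofReal hx)
    _ ≤ ∫⁻ x, ENNReal.ofReal (B * H x) := setLIntegral_le_lintegral _ _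
    _ = ENNReal.ofReal (∫ x, B * H x) :=
        (ofReal_integral_eq_lintegral_ofReal (hHi.const_mul B)
          (ae_of_all _ fun x => mul_nonneg hB (hH0 x))).symm
    _ = _ := by rw [integral_const_mul, hHint]

/-- The `L^p` error for a sawtooth wave, `p > 1`. -/
theorem FilterBound.exists_eLpNorm_sawtooth_sub_le {L : ℝ} (hL : 0 < L) {σ : ℝ → ℝ} {M : ℝ}
    (hσ : FilterBound σ 1 M) (hz : ∀ η : ℝ, 1 ≤ |η| → σ η = 0) {p : ℝ} (hp : 1 < p) :
    ∃ C : ℝ, 0 ≤ C ∧ ∀ Ω : ℝ, 0 < Ω → ∀ ξ ∈ Set.Icc 0 L,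
      eLpNorm (fun x => sawtooth L (x - ξ) -
        filteredReconstruction hL (fun x => sawtooth L (x - ξ)) σ Ω x) (ENNReal.ofReal p)
        (volume.restrict (Set.Ioc 0 L)) ≤
          ENNReal.ofReal (C * (2 * Real.pi / (L * Ω)) ^ (1 / p)) := by
  have hpi := Real.pi_pos
  have hp0 : 0 < p := by linarith
  have hp1 : 1 / p < 1 := (div_lt_one hp0).2 hp
  have hp1' : 0 < 1 / p := by positivity
  -- The exponents lie on either side of `1/p`: multiplied by `p` they become `1/2 < 1`, integrable
  -- at the jump, and `(1 + p)/2 > 1`, integrable at infinity.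
  obtain ⟨C₁, hC₁, h₁⟩ := hσ.exists_ae_norm_sawtooth_sub_le hL hz (θ := 1 / p / 2)
    (by positivity) (by linarith)
  obtain ⟨C₂, hC₂, h₂⟩ := hσ.exists_ae_norm_sawtooth_sub_le hL hz (θ := (1 / p + 1) / 2)
    (by positivity) (by linarith)
  have eα : 1 / p / 2 * p = 1 / 2 := by field_simp
  have eβ : (1 / p + 1) / 2 * p = (1 + p) / 2 := by field_simp
  obtain ⟨C, hC, hint⟩ := exists_lintegral_le_of_le_min_rpow hL (α := 1 / p / 2 * p)
    (β := (1 / p + 1) / 2 * p) (by positivity) (by rw [eα]; norm_num) (by rw [eβ]; linarith)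
  set D := max C₁ C₂ with hD
  have hD0 : 0 ≤ D := hC₁.trans (le_max_left _ _)
  refine ⟨(D ^ p * C) ^ (1 / p), by positivity, fun Ω hΩ ξ hξ => ?_⟩
  set h := 2 * Real.pi / (L * Ω)
  have hh : 0 < h := by positivity
  set E : ℝ → ℂ := fun x => sawtooth L (x - ξ) -
    filteredReconstruction hL (fun x => sawtooth L (x - ξ)) σ Ω x with hE
  have hpow : ∀ θ C' w e : ℝ, 0 ≤ e → 0 < w → C' ≤ D → w ^ θ * e ≤ C' * h ^ θ →
      e ^ p ≤ D ^ p * (w / h) ^ (-(θ * p)) := by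
    intro θ C' w e he hw hCD hle
    have h1 : e ≤ D * (w / h) ^ (-θ) := by
      rw [Real.rpow_neg (by positivity), Real.div_rpow hw.le hh.le, inv_div, ← mul_div_assoc,
        le_div_iff₀ (by positivity), mul_comm]
      exact hle.trans (by gcongr)
    calc e ^ p ≤ (D * (w / h) ^ (-θ)) ^ p := by gcongr
      _ = _ := by
        rw [Real.mul_rpow hD0 (by positivity), ← Real.rpow_mul (by positivity), neg_mul]
  have key := hint h hh ξ hξ (D ^ p) (by positivity) (fun x => ‖E x‖ ^ p) (by
    filter_upwards [h₁ Ω hΩ ξ, h₂ Ω hΩ ξ] with x hx₁ hx₂ hw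
    rw [mul_min_of_nonneg _ _ (by positivity)]
    exact le_min (hpow _ C₁ _ _ (norm_nonneg _) hw (le_max_left _ _) hx₁)
      (hpow _ C₂ _ _ (norm_nonneg _) hw (le_max_right _ _) hx₂))
  rw [eLpNorm_eq_lintegral_rpow_enorm_toReal (by simpa using hp0) ENNReal.ofReal_ne_top,
    ENNReal.toReal_ofReal hp0.le]
  have e1 : ∀ x, ‖E x‖ₑ ^ p = ENNReal.ofReal (‖E x‖ ^ p) := fun x => by
    rw [← ofReal_norm, ENNReal.ofReal_rpow_of_nonneg (norm_nonneg _) hp0.le]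
  simp only [e1]
  calc _ ≤ ENNReal.ofReal (D ^ p * (C * h)) ^ (1 / p) := ENNReal.rpow_le_rpow key hp1'.le
    _ = _ := by
      rw [ENNReal.ofReal_rpow_of_nonneg (by positivity) hp1'.le, ← mul_assoc,
        Real.mul_rpow (by positivity) hh.le]

/-- The `L^1` error for a sawtooth wave. -/
theorem FilterBound.exists_eLpNorm_one_sawtooth_sub_le {L : ℝ} (hL : 0 < L) {σ : ℝ → ℝ} {M : ℝ}
    (hσ : FilterBound σ 2 M) (hz : ∀ η : ℝ, 1 ≤ |η| → σ η = 0) :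
    ∃ C : ℝ, 0 ≤ C ∧ ∀ Ω : ℝ, 0 < Ω → ∀ ξ ∈ Set.Icc 0 L,
      eLpNorm (fun x => sawtooth L (x - ξ) -
        filteredReconstruction hL (fun x => sawtooth L (x - ξ)) σ Ω x) 1
        (volume.restrict (Set.Ioc 0 L)) ≤
          ENNReal.ofReal (C * (2 * Real.pi / (L * Ω))) := by
  have hpi := Real.pi_pos
  obtain ⟨C₁, hC₁, h₁⟩ := hσ.exists_integral_sq_sawtooth_sub_le hL hz
  obtain ⟨C, hC, hint⟩ := exists_lintegral_le_of_le_min_rpow hL (α := 0) (β := 2) le_rfl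
    one_pos one_lt_two
  refine ⟨C₁ + C₁ + C, by positivity, fun Ω hΩ ξ hξ => ?_⟩
  obtain ⟨i₁, i₂⟩ := h₁ Ω hΩ ξ
  set h := 2 * Real.pi / (L * Ω)
  have hh : 0 < h := by positivity
  set E : ℝ → ℂ := fun x => sawtooth L (x - ξ) -
    filteredReconstruction hL (fun x => sawtooth L (x - ξ)) σ Ω x with hE
  have hEm : MemLp E 2 (volume.restrict (Set.Ioc 0 L)) :=
    (memLp_sawtooth hL ξ 2).sub (memLp_filteredReconstruction hL _ σ Ω 2)
  let a : ℝ → ℝ := fun x => ‖E x‖ ^ 2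
  let b : ℝ → ℝ := fun x => (h ^ 2)⁻¹ * ‖(1 - fourierMode L 1 (x - ξ)) * E x‖ ^ 2
  have ha : Integrable a (volume.restrict (Set.Ioc 0 L)) :=
    (memLp_two_iff_integrable_sq_norm hEm.1).1 hEm
  have hb : Integrable b (volume.restrict (Set.Ioc 0 L)) := by
    have := hEm.one_sub_fourierMode_mul ξ
    exact ((memLp_two_iff_integrable_sq_norm this.1).1 this).const_mul _
  have hai : ∫⁻ x in Set.Ioc 0 L, ENNReal.ofReal (a x) ≤ ENNReal.ofReal (C₁ * h) := by
    rw [← ofReal_integral_eq_lintegral_ofReal ha (ae_of_all _ fun x => sq_nonneg _),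
      ← intervalIntegral.integral_of_le hL.le]
    exact ENNReal.ofReal_le_ofReal i₁
  have hbi : ∫⁻ x in Set.Ioc 0 L, ENNReal.ofReal (b x) ≤ ENNReal.ofReal (C₁ * h) := by
    rw [← ofReal_integral_eq_lintegral_ofReal hb (ae_of_all _ fun x => by positivity),
      ← intervalIntegral.integral_of_le hL.le, intervalIntegral.integral_const_mul]
    refine ENNReal.ofReal_le_ofReal ?_
    rw [inv_mul_le_iff₀ (by positivity)]
    exact i₂.trans_eq (by ring)
  -- With `e = |E|`, the excess `e - a - b` is at most `1` because `e ≤ 1 + e²`, and at most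
  -- `(w/h)⁻²` by the arithmetic-geometric mean inequality for `e = (we/h)(w/h)⁻¹`.
  have hfi := hint h hh ξ hξ 1 zero_le_one (fun x => ‖E x‖ - a x - b x) (ae_of_all _ fun x hw => by
    simp only [a, b, norm_mul, mul_pow, one_mul]
    set w := ‖1 - fourierMode L 1 (x - ξ)‖
    set e := ‖E x‖
    rw [neg_zero, Real.rpow_zero, Real.rpow_neg (by positivity), Real.rpow_two]
    have hbn : 0 ≤ (h ^ 2)⁻¹ * (w ^ 2 * e ^ 2) := by positivity
    refine le_min ?_ ?_
    · nlinarith [sq_nonneg (e - 1), sq_nonneg e]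
    · have e2 : (h ^ 2)⁻¹ * (w ^ 2 * e ^ 2) = (w / h * e) ^ 2 := by field_simp
      have e3 : e = (w / h * e) * (w / h)⁻¹ := by field_simp
      rw [e2, ← inv_pow]
      have := two_mul_le_add_sq (w / h * e) (w / h)⁻¹
      nlinarith [sq_nonneg e, sq_nonneg (w / h * e), sq_nonneg (w / h)⁻¹])
  rw [eLpNorm_one_eq_lintegral_enorm]
  calc ∫⁻ x in Set.Ioc 0 L, ‖E x‖ₑ
      ≤ ∫⁻ x in Set.Ioc 0 L, (ENNReal.ofReal (a x) + (ENNReal.ofReal (b x) +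
          ENNReal.ofReal (‖E x‖ - a x - b x))) := by
        refine lintegral_mono fun x => ?_
        rw [← ofReal_norm]
        calc ENNReal.ofReal ‖E x‖ = ENNReal.ofReal (a x + (b x + (‖E x‖ - a x - b x))) := by
              congr 1; ring
          _ ≤ _ := ENNReal.ofReal_add_le.trans (by gcongr; exact ENNReal.ofReal_add_le)
    _ = (∫⁻ x in Set.Ioc 0 L, ENNReal.ofReal (a x)) +
          ((∫⁻ x in Set.Ioc 0 L, ENNReal.ofReal (b x)) +
            ∫⁻ x in Set.Ioc 0 L, ENNReal.ofReal (‖E x‖ - a x - b x)) := by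
        rw [lintegral_add_left' ha.aemeasurable.ennreal_ofReal,
          lintegral_add_left' hb.aemeasurable.ennreal_ofReal]
    _ ≤ ENNReal.ofReal (C₁ * h) + (ENNReal.ofReal (C₁ * h) + ENNReal.ofReal (1 * (C * h))) := by
        gcongr
    _ = _ := by
        rw [← ENNReal.ofReal_add (by positivity) (by positivity),
          ← ENNReal.ofReal_add (by positivity) (by positivity)]
        congr 1; ring

/-! ### Remainders with quadratically decaying Fourier coefficients -/

/-- Flatness with exponent `1/p` leaves `∑ |k|^(1/p - 2)`, which converges exactly because `p > 1`.
-/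
theorem FilterBound.exists_tsum_div_sq_le {σ : ℝ → ℝ} {M : ℝ} (hσ : FilterBound σ 1 M) {p : ℝ}
    (hp : 1 < p) :
    ∃ C : ℝ, 0 ≤ C ∧ ∀ h : ℝ, 0 < h → (Summable fun k : ℤ => |1 - σ (h * k)| / (k : ℝ) ^ 2) ∧
      ∑' k : ℤ, |1 - σ (h * k)| / (k : ℝ) ^ 2 ≤ C * h ^ (1 / p) := by
  have hp0 : 0 < p := by linarith
  have hp1 : 1 / p < 1 := (div_lt_one hp0).2 hp
  have hp1' : 0 < 1 / p := by positivity
  have hM := hσ.nonneg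
  have hs := Real.summable_abs_int_rpow (b := 2 - 1 / p) (by linarith)
  refine ⟨M * ∑' k : ℤ, |(k : ℝ)| ^ (-(2 - 1 / p)),
    mul_nonneg hM (tsum_nonneg fun k => by positivity), fun h hh => ?_⟩
  have hb : ∀ k : ℤ, |1 - σ (h * k)| / (k : ℝ) ^ 2 ≤
      M * h ^ (1 / p) * |(k : ℝ)| ^ (-(2 - 1 / p)) := by
    intro k
    rcases eq_or_ne k 0 with rfl | hk
    · simp only [Int.cast_zero, ne_eq, OfNat.ofNat_ne_zero, not_false_eq_true, zero_pow, div_zero]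
      positivity
    · have hk' : (k : ℝ) ≠ 0 := by exact_mod_cast hk
      have ha : 0 < |(k : ℝ)| := abs_pos.2 hk'
      have := hσ.sub_le (1 / p) (h * k) hp1'.le hp1.le (mul_ne_zero hh.ne' hk')
      rw [abs_mul, abs_of_pos hh, Real.mul_rpow hh.le ha.le] at this
      rw [div_le_iff₀ (by positivity), neg_sub, Real.rpow_sub ha, Real.rpow_two, ← sq_abs (k : ℝ)]
      refine this.trans_eq ?_
      field_simp
  have hs' := hs.mul_left (M * h ^ (1 / p))
  have hsum : Summable fun k : ℤ => |1 - σ (h * k)| / (k : ℝ) ^ 2 :=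
    hs'.of_nonneg_of_le (fun k => by positivity) hb
  refine ⟨hsum, (hsum.tsum_le_tsum hb hs').trans_eq ?_⟩
  rw [tsum_mul_left]
  ring

/-- Endpoint `p = 1`: exponent one would diverge logarithmically, so the exponents `2` and `0` are
combined into a minimum. -/
theorem FilterBound.exists_tsum_div_sq_le_one {σ : ℝ → ℝ} {M : ℝ} (hσ : FilterBound σ 2 M) :
    ∃ C : ℝ, 0 ≤ C ∧ ∀ h : ℝ, 0 < h → (Summable fun k : ℤ => |1 - σ (h * k)| / (k : ℝ) ^ 2) ∧
      ∑' k : ℤ, |1 - σ (h * k)| / (k : ℝ) ^ 2 ≤ C * h := by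
  have hM := hσ.nonneg
  refine ⟨M * 8, by positivity, fun h hh => ?_⟩
  obtain ⟨hs, ht⟩ := summable_and_tsum_min_sq_le hh
  have hb : ∀ k : ℤ, |1 - σ (h * k)| / (k : ℝ) ^ 2 ≤ M * min (h ^ 2) (1 / (k : ℝ) ^ 2) := by
    intro k
    rcases eq_or_ne k 0 with rfl | hk
    · simp only [Int.cast_zero, ne_eq, OfNat.ofNat_ne_zero, not_false_eq_true, zero_pow, div_zero]
      positivity
    · have hk' : (k : ℝ) ≠ 0 := by exact_mod_cast hk
      have b2 := hσ.sub_le 2 (h * k) (by norm_num) le_rfl (mul_ne_zero hh.ne' hk')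
      have b0 := hσ.sub_le 0 (h * k) le_rfl (by norm_num) (mul_ne_zero hh.ne' hk')
      rw [Real.rpow_two, sq_abs, mul_pow] at b2
      rw [Real.rpow_zero, mul_one] at b0
      rw [mul_min_of_nonneg _ _ hM]
      refine le_min ?_ ?_
      · rw [div_le_iff₀ (by positivity)]; linarith
      · rw [mul_one_div]; gcongr
  have hs' := hs.mul_left M
  have hsum : Summable fun k : ℤ => |1 - σ (h * k)| / (k : ℝ) ^ 2 :=
    hs'.of_nonneg_of_le (fun k => by positivity) hb
  refine ⟨hsum, (hsum.tsum_le_tsum hb hs').trans ?_⟩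
  rw [tsum_mul_left, mul_assoc]
  gcongr

/-! ### Functions reconstructed at the rate `Ω ^ (-1/p)` -/

/-- The filtered reconstruction of `f` on `[0, L]` converges in `L^p` at the rate `Ω ^ (-1/p)`. -/
def HasFilteredRate {L : ℝ} (hL : 0 < L) (σ : ℝ → ℝ) (p : ℝ) (f : ℝ → ℂ) : Prop :=
  MemLp f 2 (volume.restrict (Set.Ioc 0 L)) ∧ ∃ C : ℝ, 0 ≤ C ∧ ∀ Ω : ℝ, 0 < Ω →
    eLpNorm (fun x => f x - filteredReconstruction hL f σ Ω x) (ENNReal.ofReal p)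
      (volume.restrict (Set.Ioc 0 L)) ≤ ENNReal.ofReal (C * Ω ^ (-(1 / p)))

theorem two_pi_div_rpow {L Ω : ℝ} (hL : 0 < L) (hΩ : 0 < Ω) (s : ℝ) :
    (2 * Real.pi / (L * Ω)) ^ s = (2 * Real.pi / L) ^ s * Ω ^ (-s) := by
  have := Real.pi_pos
  rw [← div_div, Real.div_rpow (by positivity) hΩ.le, Real.rpow_neg hΩ.le, div_eq_mul_inv]

namespace HasFilteredRate

variable {L : ℝ} {hL : 0 < L} {σ : ℝ → ℝ} {p : ℝ} {f g : ℝ → ℂ}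

theorem congr_ae (hf : HasFilteredRate hL σ p f) (h : f =ᵐ[volume.restrict (Set.Ioc 0 L)] g) :
    HasFilteredRate hL σ p g := by
  obtain ⟨hm, C, hC, hr⟩ := hf
  refine ⟨(memLp_congr_ae h).1 hm, C, hC, fun Ω hΩ => ?_⟩
  rw [← filteredReconstruction_congr_ae hL h]
  refine (eLpNorm_congr_ae ?_).trans_le (hr Ω hΩ)
  filter_upwards [h] with x hx
  rw [hx]

theorem const_mul (hf : HasFilteredRate hL σ p f) (c : ℂ) :
    HasFilteredRate hL σ p fun x => c * f x := by
  obtain ⟨hm, C, hC, hr⟩ := hf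
  refine ⟨hm.const_mul c, ‖c‖ * C, by positivity, fun Ω hΩ => ?_⟩
  have e : (fun x => c * f x - filteredReconstruction hL (fun x => c * f x) σ Ω x) =
      c • fun x => f x - filteredReconstruction hL f σ Ω x := by
    ext x
    rw [filteredReconstruction_const_mul, Pi.smul_apply, smul_eq_mul, mul_sub]
  rw [e, eLpNorm_const_smul, ← ofReal_norm, mul_assoc, ENNReal.ofReal_mul (norm_nonneg c)]
  gcongr
  exact hr Ω hΩ

theorem add (hp : 1 ≤ p) (hf : HasFilteredRate hL σ p f) (hg : HasFilteredRate hL σ p g) :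
    HasFilteredRate hL σ p fun x => f x + g x := by
  obtain ⟨hm, C, hC, hr⟩ := hf
  obtain ⟨hm', C', hC', hr'⟩ := hg
  refine ⟨hm.add hm', C + C', by positivity, fun Ω hΩ => ?_⟩
  have e : (fun x => f x + g x - filteredReconstruction hL (fun x => f x + g x) σ Ω x) =
      (fun x => f x - filteredReconstruction hL f σ Ω x) +
        fun x => g x - filteredReconstruction hL g σ Ω x := by
    ext x
    rw [filteredReconstruction_add hL hm hm', Pi.add_apply]
    ring
  rw [e, add_mul, ENNReal.ofReal_add (by positivity) (by positivity)]
  refine (eLpNorm_add_le (hm.1.sub (memLp_filteredReconstruction hL f σ Ω 2).1)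
    (hm'.1.sub (memLp_filteredReconstruction hL g σ Ω 2).1) ?_).trans
      (add_le_add (hr Ω hΩ) (hr' Ω hΩ))
  rwa [← ENNReal.ofReal_one, ENNReal.ofReal_le_ofReal_iff (by linarith)]

/-- Quadratic decay of the Fourier coefficients gives the rate `Ω ^ (-1/p)`. -/
theorem of_norm_fourierCoeffOn_le (hσ0 : σ 0 = 1) (hz : ∀ η : ℝ, 1 ≤ |η| → σ η = 0)
    (hsum : ∃ C : ℝ, 0 ≤ C ∧ ∀ h : ℝ, 0 < h →
      (Summable fun k : ℤ => |1 - σ (h * k)| / (k : ℝ) ^ 2) ∧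
      ∑' k : ℤ, |1 - σ (h * k)| / (k : ℝ) ^ 2 ≤ C * h ^ (1 / p))
    (hf : MemLp f 2 (volume.restrict (Set.Ioc 0 L))) {A : ℝ} (hA : 0 ≤ A)
    (hk : ∀ k : ℤ, k ≠ 0 → ‖fourierCoeffOn hL f k‖ ≤ A / (k : ℝ) ^ 2) :
    HasFilteredRate hL σ p f := by
  have hpi := Real.pi_pos
  obtain ⟨C, hC, hr⟩ := hsum
  refine ⟨hf, L ^ (ENNReal.ofReal p).toReal⁻¹ * (A * C * (2 * Real.pi / L) ^ (1 / p)),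
    by positivity, fun Ω hΩ => ?_⟩
  set h := 2 * Real.pi / (L * Ω) with hh_def
  have hh : 0 < h := by positivity
  obtain ⟨hs, ht⟩ := hr h hh
  have hb : ∀ k : ℤ, ‖fourierCoeffOn hL (fun x => f x - filteredReconstruction hL f σ Ω x) k‖ ≤
      A * (|1 - σ (h * k)| / (k : ℝ) ^ 2) := by
    intro k
    rw [fourierCoeffOn_sub_filteredReconstruction hL hf hz hΩ, norm_mul, Complex.norm_real,
      Real.norm_eq_abs]
    rcases eq_or_ne k 0 with rfl | hk0
    -- The mean of `f` is reproduced exactly, so no bound on the zeroth coefficient is needed.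
    · simp [hσ0]
    · calc _ ≤ |1 - σ (h * k)| * (A / (k : ℝ) ^ 2) := by gcongr; exact hk k hk0
        _ = _ := by ring
  have hs' := hs.mul_left A
  have hsum := hs'.of_nonneg_of_le (fun k => norm_nonneg _) hb
  have hae := ae_norm_le_tsum_norm_fourierCoeffOn hL
    (hf.sub (memLp_filteredReconstruction hL f σ Ω 2)) hsum
  have hle := hsum.tsum_le_tsum hb hs'
  rw [tsum_mul_left] at hle
  refine (eLpNorm_le_of_ae_bound (hae.mono fun x hx => hx.trans
    (hle.trans (mul_le_mul_of_nonneg_left ht hA)))).trans_eq ?_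
  rw [Measure.restrict_apply_univ, Real.volume_Ioc, sub_zero,
    ENNReal.ofReal_rpow_of_nonneg hL.le (by positivity), ← ENNReal.ofReal_mul (by positivity),
    hh_def, two_pi_div_rpow hL hΩ]
  congr 1
  ring

end HasFilteredRate

/-! ### Smooth pieces -/

theorem integral_fourierMode_mul_eq {L : ℝ} (hL : 0 < L) {k : ℤ} (hk : k ≠ 0) {g : ℝ → ℂ}
    (hg : ContDiff ℝ 1 g) (a b : ℝ) :
    ∫ x in a..b, fourierMode L (-k) x * g x =
      sawtoothCoeff L k * (fourierMode L (-k) a * g a - fourierMode L (-k) b * g b +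
        ∫ x in a..b, fourierMode L (-k) x * deriv g x) := by
  set w : ℂ := Complex.I * (2 * Real.pi * k / L : ℝ) with hw
  have hw0 : w ≠ 0 := by
    have : (k : ℝ) ≠ 0 := by exact_mod_cast hk
    refine mul_ne_zero Complex.I_ne_zero (Complex.ofReal_ne_zero.2 ?_)
    have := Real.pi_pos
    positivity
  have hc : Continuous (deriv g) := hg.continuous_deriv (by simp)
  have hd : ∀ x ∈ Set.uIcc a b, HasDerivAt (fun x => fourierMode L (-k) x * g x)
      (-w * (fourierMode L (-k) x * g x) + fourierMode L (-k) x * deriv g x) x := by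
    intro x _
    have := (hasDerivAt_fourierMode L (-k) x).mul
      ((hg.differentiable (by simp)) x).hasDerivAt
    convert! this using 1
    have : Complex.I * ((2 * Real.pi * ((-k : ℤ) : ℝ) / L : ℝ) : ℂ) = -w := by
      rw [hw]; push_cast; ring
    rw [this]; ring
  have hm := continuous_fourierMode L (-k)
  have i1 : IntervalIntegrable (fun x => -w * (fourierMode L (-k) x * g x)) volume a b :=
    (continuous_const.mul (hm.mul hg.continuous)).intervalIntegrable _ _
  have i2 : IntervalIntegrable (fun x => fourierMode L (-k) x * deriv g x) volume a b :=
    (hm.mul hc).intervalIntegrable _ _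
  have := intervalIntegral.integral_eq_sub_of_hasDerivAt hd (i1.add i2)
  rw [intervalIntegral.integral_add i1 i2, intervalIntegral.integral_const_mul] at this
  rw [sawtoothCoeff, ← hw, eq_comm, inv_mul_eq_iff_eq_mul₀ hw0]
  linear_combination this

/-- Integrating by parts twice leaves the first boundary terms, which are sawtooth coefficients;
everything else carries `sawtoothCoeff L k ^ 2`. -/
theorem exists_norm_integral_fourierMode_mul_sub_le {L : ℝ} (hL : 0 < L) {g : ℝ → ℂ}
    (hg : ContDiff ℝ 2 g) {a b : ℝ} (hab : a ≤ b) :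
    ∃ A : ℝ, 0 ≤ A ∧ ∀ k : ℤ, k ≠ 0 →
      ‖(∫ x in a..b, fourierMode L (-k) x * g x) -
        (g a * (fourierMode L (-k) a * sawtoothCoeff L k) -
          g b * (fourierMode L (-k) b * sawtoothCoeff L k))‖ ≤ A / (k : ℝ) ^ 2 := by
  have hpi := Real.pi_pos
  have hg' : ContDiff ℝ 1 (deriv g) := by
    have : ContDiff ℝ (1 + 1) g := by simpa [one_add_one_eq_two] using hg
    exact (contDiff_succ_iff_deriv.1 this).2.2
  have hI : 0 ≤ ∫ x in a..b, ‖deriv (deriv g) x‖ :=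
    intervalIntegral.integral_nonneg hab fun x _ => norm_nonneg _
  refine ⟨(L / (2 * Real.pi)) ^ 2 * (‖deriv g a‖ + ‖deriv g b‖ +
    ∫ x in a..b, ‖deriv (deriv g) x‖), by positivity, fun k hk => ?_⟩
  rw [integral_fourierMode_mul_eq hL hk (hg.of_le (by norm_num)),
    integral_fourierMode_mul_eq hL hk hg']
  have e : ∀ s u v I : ℂ, s * (u * g a - v * g b + s * I) - (g a * (u * s) - g b * (v * s)) =
      s ^ 2 * I := fun s u v I => by ring
  rw [e, norm_mul, norm_pow, norm_sawtoothCoeff hL, mul_pow, inv_pow, sq_abs, mul_assoc,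
    mul_div_assoc]
  gcongr
  rw [inv_mul_eq_div]
  gcongr
  refine (norm_add_le _ _).trans (add_le_add ((norm_sub_le _ _).trans ?_)
    ((intervalIntegral.norm_integral_le_integral_norm hab).trans ?_))
  · simp [norm_fourierMode]
  · simp [norm_fourierMode]

theorem fourierCoeffOn_indicator {L : ℝ} (hL : 0 < L) {a b : ℝ} (ha : 0 ≤ a) (hab : a ≤ b)
    (hb : b ≤ L) (g : ℝ → ℂ) (k : ℤ) :
    fourierCoeffOn hL ((Set.Ioc a b).indicator g) k =
      (L : ℂ)⁻¹ * ∫ x in a..b, fourierMode L (-k) x * g x := by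
  rw [fourierCoeffOn_eq_integral_fourierMode, intervalIntegral.integral_of_le hL.le,
    intervalIntegral.integral_of_le hab]
  congr 1
  have : (fun x => fourierMode L (-k) x * (Set.Ioc a b).indicator g x) =
      (Set.Ioc a b).indicator fun x => fourierMode L (-k) x * g x := by
    ext x
    by_cases hx : x ∈ Set.Ioc a b <;> simp [hx]
  rw [this, setIntegral_indicator measurableSet_Ioc,
    Set.inter_eq_self_of_subset_right (Set.Ioc_subset_Ioc ha hb)]

theorem memLp_indicator_of_continuous {L a b : ℝ} {g : ℝ → ℂ} (hg : Continuous g) (p : ENNReal) :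
    MemLp ((Set.Ioc a b).indicator g) p (volume.restrict (Set.Ioc 0 L)) := by
  obtain ⟨C, hC⟩ := (isCompact_Icc (a := a) (b := b)).exists_bound_of_continuousOn hg.continuousOn
  refine (memLp_const (max C 0)).of_le
    (hg.aestronglyMeasurable.indicator measurableSet_Ioc) (ae_of_all _ fun x => ?_)
  rw [Real.norm_of_nonneg (le_max_right C 0)]
  by_cases hx : x ∈ Set.Ioc a b
  · simpa [hx] using Or.inl (hC x (Set.Ioc_subset_Icc_self hx))
  · simp [hx]

/-! ### Assembly of piecewise smooth functions -/

namespace HasFilteredRate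

variable {L : ℝ} {hL : 0 < L} {σ : ℝ → ℝ} {p : ℝ}

/-- The sawtooth jumps up by `L`, so the weights `g a / L` and `-(g b / L)` reproduce the jumps of
the truncated function. The estimates enter as hypotheses so that `p = 1` and `p > 1` share this
argument. -/
theorem indicator_of_contDiff (hp : 1 ≤ p)
    (hrem : ∀ f : ℝ → ℂ, MemLp f 2 (volume.restrict (Set.Ioc 0 L)) → ∀ A : ℝ, 0 ≤ A →
      (∀ k : ℤ, k ≠ 0 → ‖fourierCoeffOn hL f k‖ ≤ A / (k : ℝ) ^ 2) → HasFilteredRate hL σ p f)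
    (hsaw : ∀ ξ ∈ Set.Icc 0 L, HasFilteredRate hL σ p fun x => sawtooth L (x - ξ))
    {g : ℝ → ℂ} (hg : ContDiff ℝ 2 g) {a b : ℝ} (ha : 0 ≤ a) (hab : a ≤ b) (hb : b ≤ L) :
    HasFilteredRate hL σ p ((Set.Ioc a b).indicator g) := by
  obtain ⟨A, hA, hbound⟩ := exists_norm_integral_fourierMode_mul_sub_le hL hg hab
  have hm := memLp_indicator_of_continuous (L := L) (a := a) (b := b) hg.continuous 2
  have hsa := hsaw a ⟨ha, hab.trans hb⟩
  have hsb := hsaw b ⟨ha.trans hab, hb⟩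
  have hma := (memLp_sawtooth hL a 2).const_mul (g a / L)
  have hmb := (memLp_sawtooth hL b 2).const_mul (-(g b / L))
  have hmab : MemLp (fun x => g a / L * sawtooth L (x - a) + -(g b / L) * sawtooth L (x - b)) 2
      (volume.restrict (Set.Ioc 0 L)) := hma.add hmb
  have hR := hrem (fun x => (Set.Ioc a b).indicator g x -
    (g a / L * sawtooth L (x - a) + -(g b / L) * sawtooth L (x - b))) (hm.sub hmab)
    (L⁻¹ * A) (by positivity) fun k hk => by
      rw [fourierCoeffOn_sub hL hm hmab, fourierCoeffOn_add hL hma hmb,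
        fourierCoeffOn.const_mul, fourierCoeffOn.const_mul, fourierCoeffOn_sawtooth,
        fourierCoeffOn_sawtooth, fourierCoeffOn_indicator hL ha hab hb]
      have e : ∀ I u v : ℂ, (L : ℂ)⁻¹ * I - (g a / L * u + -(g b / L) * v) =
          (L : ℂ)⁻¹ * (I - (g a * u - g b * v)) := fun I u v => by ring
      rw [e, norm_mul, norm_inv, Complex.norm_real, Real.norm_of_nonneg hL.le, mul_div_assoc]
      gcongr
      exact hbound k hk
  have := hR.add hp ((hsa.const_mul (g a / L)).add hp (hsb.const_mul (-(g b / L))))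
  simpa only [sub_add_cancel] using this

/-- Induction on a finite set of candidate break points: a candidate inside the interval splits it
in two, any other is discarded. -/
theorem indicator_of_piecewise (hp : 1 ≤ p) {F : ℝ → ℂ} {P : ℝ → Prop}
    (hsmooth : ∀ g : ℝ → ℂ, ContDiff ℝ 2 g → ∀ a b : ℝ, 0 ≤ a → a ≤ b → b ≤ L →
      HasFilteredRate hL σ p ((Set.Ioc a b).indicator g))
    (hF : ∀ a b : ℝ, a < b → (∀ y ∈ Set.Ioo a b, ¬ P y) →
      ∃ g : ℝ → ℂ, ContDiff ℝ 2 g ∧ Set.EqOn F g (Set.Ioo a b))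
    (s : Finset ℝ) : ∀ a b : ℝ, 0 ≤ a → a < b → b ≤ L → (∀ y ∈ Set.Ioo a b, P y → y ∈ s) →
      HasFilteredRate hL σ p ((Set.Ioc a b).indicator F) := by
  induction s using Finset.induction_on with
  | empty =>
    intro a b ha hab hb hs
    obtain ⟨g, hg, hEq⟩ := hF a b hab fun y hy hPy => by simpa using hs y hy hPy
    refine (hsmooth g hg a b ha hab.le hb).congr_ae ?_
    filter_upwards [ae_restrict_of_ae (Measure.ae_ne volume b)] with x hx
    by_cases hxm : x ∈ Set.Ioc a b
    · simp [hxm, hEq ⟨hxm.1, lt_of_le_of_ne hxm.2 hx⟩]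
    · simp [hxm]
  | insert c s _ ih =>
    intro a b ha hab hb hs
    by_cases hc : c ∈ Set.Ioo a b
    · have h1 := ih a c ha hc.1 (hc.2.le.trans hb) fun y hy hPy =>
        (Finset.mem_insert.1 (hs y ⟨hy.1, hy.2.trans hc.2⟩ hPy)).resolve_left hy.2.ne
      have h2 := ih c b (ha.trans hc.1.le) hc.2 hb fun y hy hPy =>
        (Finset.mem_insert.1 (hs y ⟨hc.1.trans hy.1, hy.2⟩ hPy)).resolve_left hy.1.ne'
      have := h1.add hp h2
      convert! this using 1
      rw [← Set.Ioc_union_Ioc_eq_Ioc hc.1.le hc.2.le, Set.indicator_union_of_disjoint]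
      exact Set.disjoint_left.2 fun x hx hx' => (hx.2.trans_lt hx'.1).false
    · exact ih a b ha hab hb fun y hy hPy =>
        (Finset.mem_insert.1 (hs y hy hPy)).resolve_left fun h => hc (h ▸ hy)

end HasFilteredRate

theorem IsPeriodicPiecewiseContDiff.hasFilteredRate {L : ℝ} (hL : 0 < L) {q J : ℕ}
    {ξ : Fin J → ℝ} {F : ℝ → ℂ} {σ : ℝ → ℝ} {p : ℝ} (hF : IsPeriodicPiecewiseContDiff L q ξ F)
    (hq : 2 ≤ q) (hp : 1 ≤ p)
    (hsmooth : ∀ g : ℝ → ℂ, ContDiff ℝ 2 g → ∀ a b : ℝ, 0 ≤ a → a ≤ b → b ≤ L →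
      HasFilteredRate hL σ p ((Set.Ioc a b).indicator g)) :
    HasFilteredRate hL σ p F := by
  classical
  -- All translates `ξ j + n L` in `[0, L]`; the floor and ceiling make the range of `n` finite.
  let s : Finset ℝ := Finset.univ.biUnion fun j : Fin J =>
    (Finset.Icc ⌈(0 - ξ j) / L⌉ ⌊(L - ξ j) / L⌋).image fun n : ℤ => ξ j + n * L
  have := HasFilteredRate.indicator_of_piecewise hp (F := F)
    (P := fun y => ∃ (j : Fin J) (n : ℤ), ξ j + n * L = y) hsmooth
    (fun a b hab hy => by
      obtain ⟨g, hg, hEq⟩ := hF.piecewise a b hab fun j n h => hy _ h ⟨j, n, rfl⟩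
      exact ⟨g, hg.of_le (by exact_mod_cast hq), hEq⟩) s 0 L le_rfl hL le_rfl
    (by
      rintro _ hy ⟨j, n, rfl⟩
      simp only [s, Finset.mem_biUnion, Finset.mem_univ, true_and, Finset.mem_image,
        Finset.mem_Icc]
      refine ⟨j, n, ⟨?_, ?_⟩, rfl⟩
      · rw [Int.ceil_le, div_le_iff₀ hL]; linarith [hy.1]
      · rw [Int.le_floor, le_div_iff₀ hL]; linarith [hy.2])
  refine this.congr_ae ?_
  filter_upwards [ae_restrict_mem measurableSet_Ioc] with x hx
  simp [hx]

theorem IsSpectralFilter.hasFilteredRate {L : ℝ} (hL : 0 < L) {q J : ℕ} {ξ : Fin J → ℝ}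
    {F : ℝ → ℂ} {σ : ℝ → ℝ} (hF : IsPeriodicPiecewiseContDiff L q ξ F)
    (hσ : IsSpectralFilter q σ) {p : ℝ} (hp : 1 ≤ p) (hpq : 1 < p * ((q : ℝ) - 1)) :
    HasFilteredRate hL σ p F := by
  have hpi := Real.pi_pos
  have hq1 : (1 : ℝ) < q := by
    by_contra h
    nlinarith
  have hq2 : 2 ≤ q := by exact_mod_cast hq1
  have of_saw : (∃ C : ℝ, 0 ≤ C ∧ ∀ Ω : ℝ, 0 < Ω → ∀ ξ ∈ Set.Icc 0 L,
      eLpNorm (fun x => sawtooth L (x - ξ) -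
        filteredReconstruction hL (fun x => sawtooth L (x - ξ)) σ Ω x) (ENNReal.ofReal p)
        (volume.restrict (Set.Ioc 0 L)) ≤
          ENNReal.ofReal (C * (2 * Real.pi / (L * Ω)) ^ (1 / p))) →
      ∀ ξ ∈ Set.Icc 0 L, HasFilteredRate hL σ p fun x => sawtooth L (x - ξ) := by
    rintro ⟨C, hC, h⟩ ξ hξ
    refine ⟨memLp_sawtooth hL ξ 2, C * (2 * Real.pi / L) ^ (1 / p), by positivity,
      fun Ω hΩ => (h Ω hΩ ξ hξ).trans_eq ?_⟩
    rw [two_pi_div_rpow hL hΩ, mul_assoc]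
  refine hF.hasFilteredRate hL hq2 hp fun g hg a b ha hab hb => ?_
  -- For `p = 1` the hypothesis reads `q > 2`, which supplies the second-order flatness of `σ`; for
  -- `p > 1` first-order flatness suffices.
  rcases hp.eq_or_lt with rfl | hp1
  · have hq3 : 3 ≤ q := by
      have : (2 : ℝ) < q := by linarith
      exact_mod_cast this
    obtain ⟨M, hM⟩ := hσ.exists_filterBound_two hq3
    refine HasFilteredRate.indicator_of_contDiff le_rfl
      (fun f hf A hA hk => HasFilteredRate.of_norm_fourierCoeffOn_le hσ.map_zero hσ.eq_zero
        (by simpa using hM.exists_tsum_div_sq_le_one) hf hA hk) (of_saw ?_) hg ha hab hb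
    simpa using hM.exists_eLpNorm_one_sawtooth_sub_le hL hσ.eq_zero
  · obtain ⟨M, hM⟩ := hσ.exists_filterBound_one hq2
    exact HasFilteredRate.indicator_of_contDiff hp
      (fun f hf A hA hk => HasFilteredRate.of_norm_fourierCoeffOn_le hσ.map_zero hσ.eq_zero
        (hM.exists_tsum_div_sq_le hp1) hf hA hk)
      (of_saw (hM.exists_eLpNorm_sawtooth_sub_le hL hσ.eq_zero hp1)) hg ha hab hb

theorem mainTheorem1 {L : ℝ} (hL : 0 < L) {q J : ℕ} {ξ : Fin J → ℝ} {F : ℝ → ℂ} {σ : ℝ → ℝ}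
    (hF : IsPeriodicPiecewiseContDiff L q ξ F) (hσ : IsSpectralFilter q σ) :
    (∀ p : ℝ, 1 ≤ p → 1 < p * ((q : ℝ) - 1) →
      ∃ C : ℝ, ∀ᶠ Ω : ℝ in atTop,
        eLpNorm (fun x => F x - filteredReconstruction hL F σ Ω x) (ENNReal.ofReal p)
          (volume.restrict (Set.Icc 0 L)) ≤ ENNReal.ofReal (C * Ω ^ (-(1 / p)))) ∧
    (1 < (q : ℝ) - 1 →
      ∃ C : ℝ, ∀ᶠ Ω : ℝ in atTop,
        eLpNorm (fun x => F x - filteredReconstruction hL F σ Ω x) 1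
          (volume.restrict (Set.Icc 0 L)) ≤ ENNReal.ofReal (C * Ω⁻¹)) := by
  have key : ∀ p : ℝ, 1 ≤ p → 1 < p * ((q : ℝ) - 1) →
      ∃ C : ℝ, ∀ᶠ Ω : ℝ in atTop,
        eLpNorm (fun x => F x - filteredReconstruction hL F σ Ω x) (ENNReal.ofReal p)
          (volume.restrict (Set.Icc 0 L)) ≤ ENNReal.ofReal (C * Ω ^ (-(1 / p))) := by
    intro p hp hpq
    obtain ⟨-, C, -, hC⟩ := hσ.hasFilteredRate hL hF hp hpq
    refine ⟨C, (eventually_gt_atTop 0).mono fun Ω hΩ => ?_⟩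
    rw [← Measure.restrict_congr_set (Ioc_ae_eq_Icc (μ := volume) (a := (0 : ℝ)) (b := L))]
    exact hC Ω hΩ
  refine ⟨key, fun hq => ?_⟩
  simpa [Real.rpow_neg_one] using key 1 le_rfl (by simpa using hq)
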